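/- **Setting.** Let $(S,A,P,r,u,b,\gamma,\rho)$ be a constrained Markov decision process with finite $S,A$, rewards and utilities $r,u:S\times A\to[0,1]$, discount factor $\gamma\in[0,1)$, initial distribution $\rho$ and threshold $b\in(0,1/(1-\gamma)]$. A policy assigns to each state a probability distribution on $A$. For $f:S\times A\to\mathbb R$ let $V_f^\pi(s)$, $Q_f^\pi(s,a)$ be the expected discounted sums $\mathbb E[\sum_t\gamma^t f(s_t,a_t)]$ given $s_0=s$, resp. $(s_0,a_0)=(s,a)$, put $V_f^\pi(\rho)=\mathbb E_{s\sim\rho}V_f^\pi(s)$, and let $d_\rho^\pi$ be the discounted state visitation distribution. Let $g=u-(1-\gamma)b$; $\pi^\star$ is any policy maximizing $V_r^\pi(\rho)$ subject to $V_g^\pi(\rho)\ge 0$. Assume that some policy $\bar\pi$ satisfies $V_g^{\bar\pi}(\rho)\ge\xi>0$, and let $\Lambda=[0,1/((1-\gamma)\xi)]$. For $\tau>0$ let $L_\tau(\pi,\lambda)=V_{r+\lambda g}^\pi(\rho)+\tau(\mathcal H(\pi)+\tfrac12\lambda^2)$ with $\mathcal H(\pi)=\mathbb E[\sum_t-\gamma^t\log\pi(a_t|s_t)]$,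 and let $(\pi_\tau^\star,\lambda_\tau^\star)$ be a saddle point of $L_\tau$ (max over all policies, min over $\Lambda$). **Algorithm (inexact RPG-PD).** Let $\phi_{s,a}\in\mathbb R^d$, $\|\phi_{s,a}\|\le1$, $W>0$, $\hat\Delta(A)=\{p\in\Delta(A):p_a\ge\epsilon_0/|A|\ \forall a\}$ with $\epsilon_0\in(0,1)$. Starting from $\pi_{\theta_0}(\cdot|s)\in\hat\Delta(A)$ and $\lambda_0\in\Lambda$, with random vectors $\|w_t\|\le W$, for all $s$ and $t\ge 0$, $$\pi_{\theta_{t+1}}(\cdot|s)=\operatorname*{argmax}_{p\in\hat\Delta(A)}\Big\{\sum_a p_a\phi_{s,a}^\top w_t-\tfrac1\eta\mathrm{KL}(p,\pi_{\theta_t}(\cdot|s))\Big\},\qquad \lambda_{t+1}=\operatorname*{argmin}_{\lambda\in\Lambda}\Big\{\lambda\big(V_g^{\pi_{\theta_t}}(\rho)+\tau\lambda_t\big)+\tfrac1{2\eta}(\lambda-\lambda_t)^2\Big\}.$$ Here $\pi_{\theta_t}$ denotes the policy iterate, which is not required to be log-linear. **Errors.** For a distribution $\mu$ on $S\times A$ let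 $\mathcal E_t(w,\mu)=\mathbb E_{(s,a)\sim\mu}[(\phi_{s,a}^\top w-Q^{\pi_{\theta_t}}_{r+\lambda_t g-\tau\log\pi_{\theta_t}}(s,a))^2]$ and $\Sigma_\mu=\mathbb E_\mu[\phi\phi^\top]$. Fix a distribution $\nu$ on $S\times A$; let $d_{t,\nu}$ be the discounted state-action visitation distribution of $\pi_{\theta_t}$ started from $\nu$, $w_t^\star\in\operatorname{argmin}_{w\in\mathbb R^d}\mathcal E_t(w,d_{t,\nu})$ and $\nu^\star(s,a)=d_\rho^{\pi_\tau^\star}(s)/|A|$. Assume that for all $t$ $$\mathbb E[\mathcal E_t(w_t,d_{t,\nu})-\mathcal E_t(w_t^\star,d_{t,\nu})]\le\epsilon_{\rm stat},\qquad \mathbb E[\mathcal E_t(w_t^\star,\nu^\star)]\le\epsilon_{\rm bias},$$ and that $\kappa_\nu=\sup_w\frac{w^\top\Sigma_{\nu^\star}w}{w^\top\Sigma_\nu w}<\infty$ (with $0/0=0$). **Statement.** For all $\alpha,\beta>0$ and $k\in\mathbb N$ there are constants $c,C,\epsilon_{\max}>0$, depending only on these three numbers and on the problem data (the CMDP, $\xi$,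 $\phi$, $W$, $\nu$), such that for all $0<\epsilon<\epsilon_{\max}$ the following holds with $\delta=c\,\epsilon$. If $$\alpha\delta^4\le\eta\le\beta\delta^4,\quad \alpha\delta^2\le\tau\le\beta\delta^2,\quad \epsilon_{\rm stat},\epsilon_{\rm bias}\le\beta\delta^8,\quad 0<\epsilon_0\le\beta\delta^4,\quad \min_{s,a}\pi_{\theta_0}(a|s)\ge\alpha\delta^k,$$ (that is, $\eta=\Theta(\epsilon^4)$, $\tau=\Theta(\epsilon^2)$, $\epsilon_{\rm stat},\epsilon_{\rm bias}=O(\epsilon^8)$, $\epsilon_0=O(\epsilon^4)$, and the initial policy is at least polynomially exploratory in $\epsilon$), then $$\mathbb E\big[V_r^{\pi^\star}(\rho)-V_r^{\pi_{\theta_t}}(\rho)\big]\le\epsilon\quad\text{and}\quad \mathbb E\big[-V_g^{\pi_{\theta_t}}(\rho)\big]\le\epsilon\qquad\text{for every integer } t\ge C\,\frac1{\epsilon^6}\log^2\frac1\epsilon .$$ -/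

import Mathlib

open MeasureTheory
open scoped ENNReal

noncomputable section

/-- A constrained Markov decision process `(S, A, P, r, u, b, γ, ρ)`; `P s a s'` is the probability
of moving from `s` to `s'` under the action `a`. -/
structure CMDP (S A : Type*) [Fintype S] [Fintype A] where
  P : S → A → S → ℝ
  r : S → A → ℝ
  u : S → A → ℝ
  b : ℝ
  γ : ℝ
  ρ : S → ℝ
  P_mem : ∀ s a, P s a ∈ stdSimplex ℝ S
  r_mem : ∀ s a, r s a ∈ Set.Icc (0 : ℝ) 1
  u_mem : ∀ s a, u s a ∈ Set.Icc (0 : ℝ) 1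
  γ_mem : γ ∈ Set.Ico (0 : ℝ) 1
  b_mem : b ∈ Set.Ioc (0 : ℝ) (1 / (1 - γ))
  ρ_mem : ρ ∈ stdSimplex ℝ S

/-- A stationary stochastic policy; `π s a` is the probability of the action `a` in state `s`. -/
def IsPolicy {S A : Type*} [Fintype A] (π : S → A → ℝ) : Prop :=
  ∀ s, π s ∈ stdSimplex ℝ A

/-- The restricted probability simplex: all probabilities are at least `ε₀ / |A|`. -/
def restrictedSimplex (A : Type*) [Fintype A] (ε₀ : ℝ) : Set (A → ℝ) :=
  {p | p ∈ stdSimplex ℝ A ∧ ∀ a, ε₀ / Fintype.card A ≤ p a}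

/-- Kullback-Leibler divergence of two distributions on a finite set. -/
def klDivergence {A : Type*} [Fintype A] (p q : A → ℝ) : ℝ :=
  ∑ a, p a * Real.log (p a / q a)

namespace CMDP

variable {S A : Type*} [Fintype S] [Fintype A] (M : CMDP S A)

/-- The constraint function `g = u - (1 - γ) b`; the constraint is `V_g(ρ) ≥ 0`. -/
def g (s : S) (a : A) : ℝ := M.u s a - (1 - M.γ) * M.b

/-- The joint law of `(s_t, a_t)` when `(s_0, a_0)` has law `μ`, `s_{t+1} ∼ P(· | s_t, a_t)` and
`a_{t+1} ∼ π(· | s_{t+1})`. -/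
def saLaw (π μ : S → A → ℝ) : ℕ → S → A → ℝ
  | 0 => μ
  | t + 1 => fun s' a' => ∑ s, ∑ a, saLaw π μ t s a * M.P s a s' * π s' a'

/-- The expected discounted sum `E[∑ γ^t f(s_t, a_t)]` when `(s_0, a_0)` has law `μ`. -/
def discountedSum (π μ f : S → A → ℝ) : ℝ :=
  ∑' t : ℕ, M.γ ^ t * ∑ s, ∑ a, M.saLaw π μ t s a * f s a

open Classical in
/-- The law of `(s_0, a_0)` when `s_0 = s` and `a_0 ∼ π(· | s)`. -/
def startState (π : S → A → ℝ) (s : S) : S → A → ℝ :=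
  fun s' a => if s' = s then π s' a else 0

open Classical in
/-- The law of `(s_0, a_0)` when `s_0 = s` and `a_0 = a`. -/
def startPair (s : S) (a : A) : S → A → ℝ :=
  fun s' a' => if s' = s ∧ a' = a then 1 else 0

/-- The value function `V_f^π(s)`. -/
def V (π f : S → A → ℝ) (s : S) : ℝ := M.discountedSum π (startState π s) f

/-- The value `V_f^π(ρ) = E_{s ∼ ρ} V_f^π(s)`. -/
def Vρ (π f : S → A → ℝ) : ℝ := ∑ s, M.ρ s * M.V π f s

/-- The state-action value function `Q_f^π(s, a)`. -/
def Q (π f : S → A → ℝ) (s : S) (a : A) : ℝ := M.discountedSum π (startPair s a) f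

/-- The discounted state visitation distribution `d_ρ^π`. -/
def stateVisit (π : S → A → ℝ) (s : S) : ℝ :=
  ∑ s₀, M.ρ s₀ * ((1 - M.γ) * ∑' t : ℕ, M.γ ^ t * ∑ a, M.saLaw π (startState π s₀) t s a)

/-- The discounted state-action visitation distribution of `π` started from `(s_0, a_0) ∼ ν`. -/
def saVisit (π ν : S → A → ℝ) (s : S) (a : A) : ℝ :=
  (1 - M.γ) * ∑ s₀, ∑ a₀, ν s₀ a₀ * ∑' t : ℕ, M.γ ^ t * M.saLaw π (startPair s₀ a₀) t s a

/-- `π` maximizes `V_r(ρ)` over all policies subject to `V_g(ρ) ≥ 0`. -/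
def IsOptimal (π : S → A → ℝ) : Prop :=
  IsPolicy π ∧ 0 ≤ M.Vρ π M.g ∧
    ∀ π', IsPolicy π' → 0 ≤ M.Vρ π' M.g → M.Vρ π' M.r ≤ M.Vρ π M.r

/-- Strict feasibility with slack `ξ`. -/
def Feasible (ξ : ℝ) : Prop := ∃ π, IsPolicy π ∧ ξ ≤ M.Vρ π M.g

/-- The interval `Λ = [0, 1 / ((1 - γ) ξ)]` of dual variables. -/
def dualSet (ξ : ℝ) : Set ℝ := Set.Icc 0 (1 / ((1 - M.γ) * ξ))

/-- The entropy `H(π) = E[∑ -γ^t log π(a_t | s_t)]`. -/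
def entropy (π : S → A → ℝ) : ℝ := M.Vρ π (fun s a => -Real.log (π s a))

/-- The regularized Lagrangian `L_τ(π, λ)`. -/
def regLagrangian (τ : ℝ) (π : S → A → ℝ) (lam : ℝ) : ℝ :=
  M.Vρ π (fun s a => M.r s a + lam * M.g s a) + τ * (M.entropy π + lam ^ 2 / 2)

/-- `(π, lam)` is a saddle point of `L_τ` over all policies and all dual variables in `Λ`. -/
def IsRegSaddle (ξ τ : ℝ) (π : S → A → ℝ) (lam : ℝ) : Prop :=
  IsPolicy π ∧ lam ∈ M.dualSet ξ ∧
    (∀ π', IsPolicy π' → M.regLagrangian τ π' lam ≤ M.regLagrangian τ π lam) ∧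
    ∀ lam' ∈ M.dualSet ξ, M.regLagrangian τ π lam ≤ M.regLagrangian τ π lam'

/-- The regularized state-action value `Q_{r + λ g + τ ψ}^π` with `ψ = -log π`. -/
def regQ (τ : ℝ) (π : S → A → ℝ) (lam : ℝ) : S → A → ℝ :=
  M.Q π (fun s a => M.r s a + lam * M.g s a + τ * -Real.log (π s a))

/-- The distribution `ν⋆(s, a) = d_ρ^π(s) Unif_A(a)`. -/
def transferLaw (π : S → A → ℝ) (s : S) (_a : A) : ℝ :=
  M.stateVisit π s * (1 / Fintype.card A)

variable {d : ℕ} (φ : S → A → EuclideanSpace ℝ (Fin d))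

/-- The compatible function approximation error
`E_{(s, a) ∼ μ} (φ_{s, a}ᵀ w - Q_{r + λ g + τ ψ}^π(s, a))²`. -/
def approxError (τ : ℝ) (π : S → A → ℝ) (lam : ℝ) (μ : S → A → ℝ)
    (w : EuclideanSpace ℝ (Fin d)) : ℝ :=
  ∑ s, ∑ a, μ s a * (inner ℝ (φ s a) w - M.regQ τ π lam s a) ^ 2

/-- The quadratic form `wᵀ Σ_μ w` of the covariance matrix `Σ_μ = E_{(s, a) ∼ μ} φ φᵀ`. -/
def covForm (μ : S → A → ℝ) (w : EuclideanSpace ℝ (Fin d)) : ℝ :=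
  ∑ s, ∑ a, μ s a * (inner ℝ (φ s a) w) ^ 2

/-- The relative condition number `sup_w (wᵀ Σ_{μ'} w) / (wᵀ Σ_μ w)`, possibly infinite; in `ℝ≥0∞`
one has `0 / 0 = 0` and `x / 0 = ∞` for `x ≠ 0`. -/
def relCondNumber (μ' μ : S → A → ℝ) : ℝ≥0∞ :=
  ⨆ w, ENNReal.ofReal (covForm φ μ' w) / ENNReal.ofReal (covForm φ μ w)

/-- Inexact RPG-PD. The policy iterates `π t`, the dual iterates `lam t` and the directions `w t`
are random variables on `Ω`. The policies are only required to solve the mirror ascent step over the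
restricted simplex; they may, but need not, be log-linear policies. -/
structure IsInexactRPGPD {Ω : Type*} [MeasurableSpace Ω] (ξ ε₀ η τ W : ℝ)
    (π : ℕ → Ω → S → A → ℝ) (lam : ℕ → Ω → ℝ) (w : ℕ → Ω → EuclideanSpace ℝ (Fin d)) : Prop where
  measurable_π : ∀ t, Measurable (π t)
  measurable_lam : ∀ t, Measurable (lam t)
  measurable_w : ∀ t, Measurable (w t)
  norm_w_le : ∀ t ω, ‖w t ω‖ ≤ W
  π_zero_mem : ∀ ω s, π 0 ω s ∈ restrictedSimplex A ε₀
  lam_zero_mem : ∀ ω, lam 0 ω ∈ M.dualSet ξ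
  π_succ_mem : ∀ t ω s, π (t + 1) ω s ∈ restrictedSimplex A ε₀
  π_succ_max : ∀ t ω s, IsMaxOn
    (fun p : A → ℝ =>
      ∑ a, p a * inner ℝ (φ s a) (w t ω) - 1 / η * klDivergence p (π t ω s))
    (restrictedSimplex A ε₀) (π (t + 1) ω s)
  lam_succ_mem : ∀ t ω, lam (t + 1) ω ∈ M.dualSet ξ
  lam_succ_min : ∀ t ω, IsMinOn
    (fun l : ℝ => l * (M.Vρ (π t ω) M.g + τ * lam t ω) + 1 / (2 * η) * (l - lam t ω) ^ 2)
    (M.dualSet ξ) (lam (t + 1) ω)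

/-- The assumption on the statistical error, the transfer error and the relative condition number.
Here `wstar t` minimizes the approximation error under the on-policy distribution `d_{t,ν}` over all
of `ℝ^d`, and `πτ` is the policy of the regularized saddle point. -/
structure BoundedErrors {Ω : Type*} [MeasurableSpace Ω] (ℙ : Measure Ω) (τ : ℝ)
    (ν πτ : S → A → ℝ) (π : ℕ → Ω → S → A → ℝ) (lam : ℕ → Ω → ℝ)
    (w wstar : ℕ → Ω → EuclideanSpace ℝ (Fin d)) (εstat εbias : ℝ) : Prop where
  wstar_min : ∀ t ω v,
    M.approxError φ τ (π t ω) (lam t ω) (M.saVisit (π t ω) ν) (wstar t ω) ≤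
      M.approxError φ τ (π t ω) (lam t ω) (M.saVisit (π t ω) ν) v
  stat_integrable : ∀ t, Integrable (fun ω =>
    M.approxError φ τ (π t ω) (lam t ω) (M.saVisit (π t ω) ν) (w t ω) -
      M.approxError φ τ (π t ω) (lam t ω) (M.saVisit (π t ω) ν) (wstar t ω)) ℙ
  stat_le : ∀ t, ∫ ω,
    (M.approxError φ τ (π t ω) (lam t ω) (M.saVisit (π t ω) ν) (w t ω) -
      M.approxError φ τ (π t ω) (lam t ω) (M.saVisit (π t ω) ν) (wstar t ω)) ∂ℙ ≤ εstat
  bias_integrable : ∀ t, Integrable (fun ω =>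
    M.approxError φ τ (π t ω) (lam t ω) (M.transferLaw πτ) (wstar t ω)) ℙ
  bias_le : ∀ t, ∫ ω,
    M.approxError φ τ (π t ω) (lam t ω) (M.transferLaw πτ) (wstar t ω) ∂ℙ ≤ εbias
  relCondNumber_lt_top : relCondNumber φ (M.transferLaw πτ) ν < ⊤

end CMDP

end

/-! The proof is a Lyapunov argument around the regularized saddle point. The potential is the KL
divergence from (a uniform mixture of) the saddle policy to the iterate, averaged over the states
visited by the saddle policy and divided by `1 - γ`, plus half the squared distance of the dual
variables.

Three inequalities make it contract. Mirror ascent and projected gradient descent each bound a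
linearized gain by the decrease of their own distance plus a second-order term
(`mirror_ascent_step`, `projected_descent_step`). By the performance difference lemma, these
linearized gains dominate `τ` times the unmixed potential, because entropy and `λ² / 2` make the
Lagrangian strongly concave-convex (`IsRegSaddle.gap`). Hence `potential_step`: the potential
shrinks by the factor `1 - ητ` up to errors.

The algorithm uses `φᵀ w` instead of the exact action values. The resulting error is measured under
`transferLaw`, and the relative condition number moves its statistical part there from the on-policy
law. Only `φᵀ w` has to be bounded in the mirror step; the action values, which contain `log π`, do
not.

With `δ = c ε`, the expected error per step is `η · O(δ⁴)`, so the stationary level is `O(δ⁴ / τ) =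
O(δ²)`, to which mixing adds `√ε₀ = O(δ²)`. The initial potential is logarithmic in `1 / ε` and is
forgotten at rate `ητ`, of order `ε⁶`. A potential of order `δ²` means values within `O(δ)` of those
of the saddle policy, which is itself `O(τ)`-optimal and `O(τ)`-feasible for the original problem.
Taking `c` to be the reciprocal of the total constant makes the final error at most `ε`. -/

namespace CMDP

/-! ### Occupancy measures, the flow equation and the performance difference lemma. -/

section Occupancy

variable {S A : Type*} [Fintype S] [Fintype A] (M : CMDP S A) {π : S → A → ℝ}

lemma one_sub_γ_pos : 0 < 1 - M.γ := by
  have := M.γ_mem.2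
  linarith

/-- Markov kernels contract the `ℓ¹` norm. Allowing signed `μ` keeps summability, and with it the
linearity lemmas, free of sign conditions. -/
lemma sum_abs_saLaw_le (hπ : IsPolicy π) (μ : S → A → ℝ) (t : ℕ) :
    ∑ s, ∑ a, |M.saLaw π μ t s a| ≤ ∑ s, ∑ a, |μ s a| := by
  induction t with
  | zero => simp [saLaw]
  | succ t ih =>
    refine le_trans ?_ ih
    have h1 : ∀ s' a', |M.saLaw π μ (t + 1) s' a'| ≤
        ∑ s, ∑ a, |M.saLaw π μ t s a| * M.P s a s' * π s' a' := by
      intro s' a'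
      simp only [saLaw]
      refine (Finset.abs_sum_le_sum_abs _ _).trans (Finset.sum_le_sum fun s _ => ?_)
      refine (Finset.abs_sum_le_sum_abs _ _).trans (Finset.sum_le_sum fun a _ => ?_)
      rw [abs_mul, abs_mul, abs_of_nonneg ((M.P_mem s a).1 s'), abs_of_nonneg ((hπ s').1 a')]
    calc ∑ s', ∑ a', |M.saLaw π μ (t + 1) s' a'|
        ≤ ∑ s', ∑ a', ∑ s, ∑ a, |M.saLaw π μ t s a| * M.P s a s' * π s' a' :=
          Finset.sum_le_sum fun s' _ => Finset.sum_le_sum fun a' _ => h1 s' a'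
      _ = ∑ s', ∑ s, ∑ a, |M.saLaw π μ t s a| * M.P s a s' := by
          refine Finset.sum_congr rfl fun s' _ => ?_
          simp_rw [← Finset.sum_mul]
          rw [← Finset.mul_sum, (hπ s').2, mul_one]
      _ = ∑ s, ∑ a, |M.saLaw π μ t s a| := by
          rw [Finset.sum_comm]
          refine Finset.sum_congr rfl fun s _ => ?_
          rw [Finset.sum_comm]
          refine Finset.sum_congr rfl fun a _ => ?_
          rw [← Finset.mul_sum, (M.P_mem s a).2, mul_one]

lemma abs_saLaw_le (hπ : IsPolicy π) (μ : S → A → ℝ) (t : ℕ) (s : S) (a : A) :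
    |M.saLaw π μ t s a| ≤ ∑ s, ∑ a, |μ s a| := by
  refine le_trans ?_ (M.sum_abs_saLaw_le hπ μ t)
  refine (Finset.single_le_sum (f := fun a => |M.saLaw π μ t s a|)
    (fun a _ => abs_nonneg _) (Finset.mem_univ a)).trans ?_
  exact Finset.single_le_sum (f := fun s => ∑ a, |M.saLaw π μ t s a|)
    (fun s _ => Finset.sum_nonneg fun a _ => abs_nonneg _) (Finset.mem_univ s)

lemma saLaw_nonneg (hπ : IsPolicy π) {μ : S → A → ℝ} (hμ : ∀ s a, 0 ≤ μ s a) (t : ℕ) :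
    ∀ s a, 0 ≤ M.saLaw π μ t s a := by
  induction t with
  | zero => exact hμ
  | succ t ih =>
    intro s' a'
    exact Finset.sum_nonneg fun s _ => Finset.sum_nonneg fun a _ =>
      mul_nonneg (mul_nonneg (ih s a) ((M.P_mem s a).1 s')) ((hπ s').1 a')

lemma summable_saLaw (hπ : IsPolicy π) (μ : S → A → ℝ) (s : S) (a : A) :
    Summable fun t : ℕ => M.γ ^ t * M.saLaw π μ t s a := by
  refine Summable.of_norm_bounded (g := fun t : ℕ => M.γ ^ t * ∑ s, ∑ a, |μ s a|)
    ((summable_geometric_of_lt_one M.γ_mem.1 M.γ_mem.2).mul_right _) fun t => ?_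
  rw [Real.norm_eq_abs, abs_mul, abs_of_nonneg (pow_nonneg M.γ_mem.1 t)]
  exact mul_le_mul_of_nonneg_left (M.abs_saLaw_le hπ μ t s a) (pow_nonneg M.γ_mem.1 t)

lemma saLaw_sum {ι : Type*} [Fintype ι] (π : S → A → ℝ) (c : ι → ℝ) (μ : ι → S → A → ℝ) (t : ℕ) :
    ∀ s a, M.saLaw π (fun s a => ∑ i, c i * μ i s a) t s a = ∑ i, c i * M.saLaw π (μ i) t s a := by
  induction t with
  | zero => intro s a; rfl
  | succ t ih =>
    intro s' a'
    simp only [saLaw, ih, Finset.mul_sum, Finset.sum_mul]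
    symm
    rw [Finset.sum_comm]
    refine Finset.sum_congr rfl fun s _ => ?_
    rw [Finset.sum_comm]
    exact Finset.sum_congr rfl fun a _ => Finset.sum_congr rfl fun i _ => by ring

/-- The law of `(s_{t+1}, a_{t+1})` when `(s_t, a_t)` has law `μ`. -/
noncomputable def stepLaw (π μ : S → A → ℝ) (s' : S) (a' : A) : ℝ :=
  ∑ s, ∑ a, μ s a * M.P s a s' * π s' a'

lemma saLaw_stepLaw (π μ : S → A → ℝ) (t : ℕ) :
    M.saLaw π (M.stepLaw π μ) t = M.saLaw π μ (t + 1) := by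
  induction t with
  | zero => rfl
  | succ t ih =>
    funext s' a'
    rw [saLaw, ih]
    rfl

/-- The unnormalized discounted occupancy measure of `π` started from the law `μ`. -/
noncomputable def occupancy (π μ : S → A → ℝ) (s : S) (a : A) : ℝ := ∑' t : ℕ, M.γ ^ t * M.saLaw π μ t s a

lemma discountedSum_eq (hπ : IsPolicy π) (μ f : S → A → ℝ) :
    M.discountedSum π μ f = ∑ s, ∑ a, M.occupancy π μ s a * f s a := by
  have h : ∀ s a, HasSum (fun t : ℕ => M.γ ^ t * M.saLaw π μ t s a * f s a)
      (M.occupancy π μ s a * f s a) := fun s a =>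
    (M.summable_saLaw hπ μ s a).hasSum.mul_right _
  have := hasSum_sum (s := Finset.univ) fun s _ => hasSum_sum (s := Finset.univ) fun a _ => h s a
  rw [discountedSum, ← this.tsum_eq]
  congr 1
  funext t
  simp only [Finset.mul_sum, mul_assoc]

lemma occupancy_nonneg (hπ : IsPolicy π) {μ : S → A → ℝ} (hμ : ∀ s a, 0 ≤ μ s a) (s : S) (a : A) :
    0 ≤ M.occupancy π μ s a :=
  tsum_nonneg fun t => mul_nonneg (pow_nonneg M.γ_mem.1 t) (M.saLaw_nonneg hπ hμ t s a)

lemma le_occupancy (hπ : IsPolicy π) {μ : S → A → ℝ} (hμ : ∀ s a, 0 ≤ μ s a) (s : S) (a : A) :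
    μ s a ≤ M.occupancy π μ s a := by
  have := (M.summable_saLaw hπ μ s a).le_tsum 0 fun t _ =>
    mul_nonneg (pow_nonneg M.γ_mem.1 t) (M.saLaw_nonneg hπ hμ t s a)
  simpa [saLaw, occupancy] using this

lemma occupancy_sum {ι : Type*} [Fintype ι] (hπ : IsPolicy π) (c : ι → ℝ) (μ : ι → S → A → ℝ)
    (s : S) (a : A) :
    M.occupancy π (fun s a => ∑ i, c i * μ i s a) s a = ∑ i, c i * M.occupancy π (μ i) s a := by
  have := hasSum_sum (s := Finset.univ) fun i _ =>
    (M.summable_saLaw hπ (μ i) s a).hasSum.mul_left (c i)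
  rw [occupancy]
  simp only [occupancy]
  rw [← this.tsum_eq]
  congr 1
  funext t
  rw [saLaw_sum, Finset.mul_sum]
  exact Finset.sum_congr rfl fun i _ => by ring

lemma occupancy_eq_add (hπ : IsPolicy π) (μ : S → A → ℝ) (s : S) (a : A) :
    M.occupancy π μ s a = μ s a + M.γ * M.occupancy π (M.stepLaw π μ) s a := by
  rw [occupancy, (M.summable_saLaw hπ μ s a).tsum_eq_zero_add, occupancy, ← tsum_mul_left]
  simp only [saLaw_stepLaw, pow_zero, one_mul, pow_succ', mul_assoc]
  rfl

lemma discountedSum_sum {ι : Type*} [Fintype ι] (hπ : IsPolicy π) (c : ι → ℝ) (μ : ι → S → A → ℝ)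
    (f : S → A → ℝ) :
    M.discountedSum π (fun s a => ∑ i, c i * μ i s a) f =
      ∑ i, c i * M.discountedSum π (μ i) f := by
  simp only [M.discountedSum_eq hπ, M.occupancy_sum hπ, Finset.mul_sum, Finset.sum_mul]
  symm
  rw [Finset.sum_comm]
  refine Finset.sum_congr rfl fun s _ => ?_
  rw [Finset.sum_comm]
  exact Finset.sum_congr rfl fun a _ => Finset.sum_congr rfl fun i _ => by ring

lemma discountedSum_eq_add (hπ : IsPolicy π) (μ f : S → A → ℝ) :
    M.discountedSum π μ f =
      ∑ s, ∑ a, μ s a * f s a + M.γ * M.discountedSum π (M.stepLaw π μ) f := by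
  simp only [M.discountedSum_eq hπ, Finset.mul_sum, ← Finset.sum_add_distrib]
  refine Finset.sum_congr rfl fun s _ => Finset.sum_congr rfl fun a _ => ?_
  rw [M.occupancy_eq_add hπ μ]
  ring

omit [Fintype S] in
lemma startState_eq_sum (π : S → A → ℝ) (s : S) :
    startState π s = fun s' a' => ∑ a, π s a * startPair s a s' a' := by
  classical
  funext s' a'
  by_cases h : s' = s
  · subst h
    simp [startState, startPair]
  · simp [startState, startPair, h]

lemma stepLaw_startPair (π : S → A → ℝ) (s : S) (a : A) :
    M.stepLaw π (startPair s a) = fun s' a' => ∑ x, M.P s a x * startState π x s' a' := by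
  classical
  funext s' a'
  simp [stepLaw, startState, startPair, ite_and]

lemma V_eq_sum_Q (hπ : IsPolicy π) (f : S → A → ℝ) (s : S) :
    M.V π f s = ∑ a, π s a * M.Q π f s a := by
  rw [V, startState_eq_sum, M.discountedSum_sum hπ]
  rfl

lemma Q_eq_add (hπ : IsPolicy π) (f : S → A → ℝ) (s : S) (a : A) :
    M.Q π f s a = f s a + M.γ * ∑ s', M.P s a s' * M.V π f s' := by
  classical
  rw [Q, M.discountedSum_eq_add hπ, stepLaw_startPair, M.discountedSum_sum hπ]
  congr 1
  simp [startPair, ite_and]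

/-- The law of `(s_0, a_0)` when `s_0 ∼ ρ` and `a_0 ∼ π(· | s_0)`. -/
noncomputable def initLaw (π : S → A → ℝ) (s : S) (a : A) : ℝ := M.ρ s * π s a

lemma initLaw_eq_sum (π : S → A → ℝ) :
    M.initLaw π = fun s a => ∑ s₀, M.ρ s₀ * startState π s₀ s a := by
  classical
  funext s a
  simp [initLaw, startState]

lemma initLaw_nonneg (hπ : IsPolicy π) (s : S) (a : A) : 0 ≤ M.initLaw π s a :=
  mul_nonneg (M.ρ_mem.1 s) ((hπ s).1 a)

lemma Vρ_eq_discountedSum (hπ : IsPolicy π) (f : S → A → ℝ) :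
    M.Vρ π f = M.discountedSum π (M.initLaw π) f := by
  rw [initLaw_eq_sum, M.discountedSum_sum hπ]
  rfl

lemma stateVisit_eq (hπ : IsPolicy π) (s : S) :
    M.stateVisit π s = (1 - M.γ) * ∑ a, M.occupancy π (M.initLaw π) s a := by
  have h : ∀ s₀, ∑' t : ℕ, M.γ ^ t * ∑ a, M.saLaw π (startState π s₀) t s a =
      ∑ a, M.occupancy π (startState π s₀) s a := by
    intro s₀
    have := hasSum_sum (s := Finset.univ) fun a _ =>
      (M.summable_saLaw hπ (startState π s₀) s a).hasSum
    simp only [occupancy]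
    rw [← this.tsum_eq]
    simp only [Finset.mul_sum]
  simp only [stateVisit, h, initLaw_eq_sum, M.occupancy_sum hπ]
  rw [Finset.sum_comm, Finset.mul_sum]
  refine Finset.sum_congr rfl fun s₀ _ => ?_
  rw [← Finset.mul_sum]
  ring

lemma stateVisit_nonneg (hπ : IsPolicy π) (s : S) : 0 ≤ M.stateVisit π s := by
  rw [M.stateVisit_eq hπ]
  exact mul_nonneg M.one_sub_γ_pos.le
    (Finset.sum_nonneg fun a _ => M.occupancy_nonneg hπ (M.initLaw_nonneg hπ) s a)

/-- Starting from a law that disintegrates along `π`, so does every later law. -/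
lemma saLaw_initLaw_eq (hπ : IsPolicy π) (t : ℕ) (s : S) (a : A) :
    M.saLaw π (M.initLaw π) t s a = (∑ a', M.saLaw π (M.initLaw π) t s a') * π s a := by
  cases t with
  | zero => simp only [saLaw, initLaw, ← Finset.mul_sum, (hπ s).2, mul_one]
  | succ t =>
    simp only [saLaw, ← Finset.sum_mul, ← Finset.mul_sum, (hπ s).2, mul_one]

lemma occupancy_initLaw (hπ : IsPolicy π) (s : S) (a : A) :
    (1 - M.γ) * M.occupancy π (M.initLaw π) s a = M.stateVisit π s * π s a := by
  have h1 := hasSum_sum (s := Finset.univ) fun a' _ =>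
      (M.summable_saLaw hπ (M.initLaw π) s a').hasSum
  have h2 := h1.mul_right (π s a)
  rw [M.stateVisit_eq hπ, mul_assoc]
  congr 1
  refine Eq.trans ?_ h2.tsum_eq
  rw [occupancy]
  congr 1
  funext t
  rw [saLaw_initLaw_eq M hπ, ← Finset.mul_sum, mul_assoc]

lemma one_sub_γ_mul_Vρ (hπ : IsPolicy π) (f : S → A → ℝ) :
    (1 - M.γ) * M.Vρ π f = ∑ s, M.stateVisit π s * ∑ a, π s a * f s a := by
  rw [M.Vρ_eq_discountedSum hπ, M.discountedSum_eq hπ, Finset.mul_sum]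
  refine Finset.sum_congr rfl fun s _ => ?_
  rw [Finset.mul_sum, Finset.mul_sum]
  refine Finset.sum_congr rfl fun a _ => ?_
  rw [← mul_assoc, M.occupancy_initLaw hπ, mul_assoc]

/-- The flow equation for the discounted state visitation distribution. -/
lemma stateVisit_flow (hπ : IsPolicy π) (s' : S) :
    M.stateVisit π s' = (1 - M.γ) * M.ρ s' +
      M.γ * ∑ s, ∑ a, M.stateVisit π s * π s a * M.P s a s' := by
  have hocc : ∀ s a, M.occupancy π (M.stepLaw π (M.initLaw π)) s a =
      (∑ x, ∑ y, M.occupancy π (M.initLaw π) x y * M.P x y s) * π s a := by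
    intro s a
    have h := hasSum_sum (s := Finset.univ) fun x _ => hasSum_sum (s := Finset.univ) fun y _ =>
      ((M.summable_saLaw hπ (M.initLaw π) x y).hasSum.mul_right (M.P x y s))
    have h2 := h.mul_right (π s a)
    refine Eq.trans ?_ h2.tsum_eq
    rw [occupancy]
    congr 1
    funext t
    rw [saLaw_stepLaw, saLaw]
    simp only [Finset.mul_sum, Finset.sum_mul, mul_assoc]
  rw [M.stateVisit_eq hπ s']
  simp_rw [M.occupancy_eq_add hπ (M.initLaw π) s', hocc, ← M.occupancy_initLaw hπ]
  rw [Finset.sum_add_distrib]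
  simp only [initLaw, ← Finset.mul_sum, (hπ s').2, mul_assoc, mul_one]
  ring

lemma sum_stateVisit (hπ : IsPolicy π) : ∑ s, M.stateVisit π s = 1 := by
  have h : ∑ s, M.stateVisit π s = (1 - M.γ) + M.γ * ∑ s, M.stateVisit π s := by
    conv_lhs => rw [Finset.sum_congr rfl fun s' _ => M.stateVisit_flow hπ s']
    rw [Finset.sum_add_distrib, ← Finset.mul_sum, M.ρ_mem.2, mul_one, ← Finset.mul_sum,
      Finset.sum_comm]
    congr 2
    refine Finset.sum_congr rfl fun s _ => ?_
    rw [Finset.sum_comm]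
    simp only [← Finset.mul_sum, (M.P_mem s _).2, mul_one, (hπ s).2]
  have := M.one_sub_γ_pos
  have h2 : (1 - M.γ) * (∑ s, M.stateVisit π s - 1) = 0 := by linarith
  rcases mul_eq_zero.1 h2 with h3 | h3 <;> linarith

/-- The performance difference lemma. -/
lemma performance_difference {π' : S → A → ℝ} (hπ : IsPolicy π) (hπ' : IsPolicy π')
    (f : S → A → ℝ) :
    (1 - M.γ) * (M.Vρ π' f - M.Vρ π f) =
      ∑ s, M.stateVisit π' s * ∑ a, (π' s a - π s a) * M.Q π f s a := by
  have h1 : ∀ s, ∑ a, (π' s a - π s a) * M.Q π f s a =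
      ∑ a, π' s a * f s a + M.γ * ∑ a, ∑ s', π' s a * M.P s a s' * M.V π f s' - M.V π f s := by
    intro s
    rw [M.V_eq_sum_Q hπ f s]
    simp only [sub_mul, Finset.sum_sub_distrib]
    congr 1
    rw [Finset.mul_sum, ← Finset.sum_add_distrib]
    refine Finset.sum_congr rfl fun a _ => ?_
    rw [M.Q_eq_add hπ, mul_add, Finset.mul_sum, Finset.mul_sum, Finset.mul_sum]
    congr 1
    exact Finset.sum_congr rfl fun s' _ => by ring
  -- The flow equation of `π'` is tested against the value function of `π`; this replaces
  -- telescoping along trajectories.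
  have h2 : ∑ s', M.stateVisit π' s' * M.V π f s' = (1 - M.γ) * M.Vρ π f +
      M.γ * ∑ s, M.stateVisit π' s * ∑ a, ∑ s', π' s a * M.P s a s' * M.V π f s' := by
    conv_lhs => rw [Finset.sum_congr rfl fun s' _ => by rw [M.stateVisit_flow hπ' s']]
    simp only [add_mul, Finset.sum_add_distrib, Vρ, Finset.mul_sum, Finset.sum_mul]
    congr 1
    · exact Finset.sum_congr rfl fun s _ => by ring
    · rw [Finset.sum_comm]
      refine Finset.sum_congr rfl fun s _ => ?_
      rw [Finset.sum_comm]
      exact Finset.sum_congr rfl fun a _ => Finset.sum_congr rfl fun s' _ => by ring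
  simp only [h1, mul_sub, mul_add, Finset.sum_sub_distrib, Finset.sum_add_distrib]
  rw [← mul_sub, mul_sub, M.one_sub_γ_mul_Vρ hπ' f, h2, Finset.mul_sum]
  have h3 : ∀ s, M.stateVisit π' s *
      (M.γ * ∑ a, ∑ s', π' s a * M.P s a s' * M.V π f s') =
      M.γ * (M.stateVisit π' s * ∑ a, ∑ s', π' s a * M.P s a s' * M.V π f s') := fun s => by ring
  simp only [h3]
  ring

/-! ### Bounds, linearity and measurability of values. -/

lemma abs_Q_le (hπ : IsPolicy π) {f : S → A → ℝ} {B : ℝ} (hf : ∀ s a, |f s a| ≤ B)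
    (s : S) (a : A) : |M.Q π f s a| ≤ B / (1 - M.γ) := by
  classical
  have hmass : ∑ s', ∑ a', |startPair s a s' a'| = (1 : ℝ) := by
    have : ∀ s' a', |startPair s a s' a'| = (startPair s a s' a' : ℝ) := fun s' a' => by
      unfold startPair; split_ifs <;> simp
    simp only [this]
    simp [startPair, ite_and]
  have hB : 0 ≤ B := (abs_nonneg _).trans (hf s a)
  have hs : HasSum (fun t : ℕ => M.γ ^ t * B) (B / (1 - M.γ)) := by
    rw [div_eq_inv_mul]
    exact (hasSum_geometric_of_lt_one M.γ_mem.1 M.γ_mem.2).mul_right B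
  rw [← Real.norm_eq_abs]
  refine tsum_of_norm_bounded hs fun t => ?_
  rw [Real.norm_eq_abs, abs_mul, abs_of_nonneg (pow_nonneg M.γ_mem.1 t)]
  refine mul_le_mul_of_nonneg_left ?_ (pow_nonneg M.γ_mem.1 t)
  calc |∑ s', ∑ a', M.saLaw π (startPair s a) t s' a' * f s' a'|
      ≤ ∑ s', ∑ a', |M.saLaw π (startPair s a) t s' a'| * B := by
        refine (Finset.abs_sum_le_sum_abs _ _).trans (Finset.sum_le_sum fun s' _ => ?_)
        refine (Finset.abs_sum_le_sum_abs _ _).trans (Finset.sum_le_sum fun a' _ => ?_)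
        rw [abs_mul]
        exact mul_le_mul_of_nonneg_left (hf s' a') (abs_nonneg _)
    _ = (∑ s', ∑ a', |M.saLaw π (startPair s a) t s' a'|) * B := by
        simp only [Finset.sum_mul]
    _ ≤ 1 * B := mul_le_mul_of_nonneg_right (hmass ▸ M.sum_abs_saLaw_le hπ _ t) hB
    _ = B := one_mul B

lemma abs_Vρ_le (hπ : IsPolicy π) {f : S → A → ℝ} {B : ℝ} (hf : ∀ s a, |f s a| ≤ B) :
    |M.Vρ π f| ≤ B / (1 - M.γ) := by
  rw [le_div_iff₀ M.one_sub_γ_pos, mul_comm, ← abs_of_pos M.one_sub_γ_pos, ← abs_mul,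
    M.one_sub_γ_mul_Vρ hπ, ← one_mul B, ← M.sum_stateVisit hπ, Finset.sum_mul]
  refine (Finset.abs_sum_le_sum_abs _ _).trans (Finset.sum_le_sum fun s _ => ?_)
  rw [abs_mul, abs_of_nonneg (M.stateVisit_nonneg hπ s)]
  refine mul_le_mul_of_nonneg_left ?_ (M.stateVisit_nonneg hπ s)
  refine (Finset.abs_sum_le_sum_abs _ _).trans ?_
  rw [← one_mul B, ← (hπ s).2, Finset.sum_mul]
  refine Finset.sum_le_sum fun a _ => ?_
  rw [abs_mul, abs_of_nonneg ((hπ s).1 a)]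
  exact mul_le_mul_of_nonneg_left (hf s a) ((hπ s).1 a)

lemma Vρ_add (hπ : IsPolicy π) (f h : S → A → ℝ) :
    M.Vρ π (fun s a => f s a + h s a) = M.Vρ π f + M.Vρ π h := by
  simp only [M.Vρ_eq_discountedSum hπ, M.discountedSum_eq hπ, mul_add, Finset.sum_add_distrib]

lemma Vρ_smul (hπ : IsPolicy π) (c : ℝ) (f : S → A → ℝ) :
    M.Vρ π (fun s a => c * f s a) = c * M.Vρ π f := by
  simp only [M.Vρ_eq_discountedSum hπ, M.discountedSum_eq hπ, Finset.mul_sum]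
  exact Finset.sum_congr rfl fun s _ => Finset.sum_congr rfl fun a _ => by ring

lemma abs_r_le (s : S) (a : A) : |M.r s a| ≤ 1 := by
  have := M.r_mem s a
  rw [abs_le]; constructor <;> linarith [this.1, this.2]

lemma abs_g_le (s : S) (a : A) : |M.g s a| ≤ 1 := by
  have h := M.u_mem s a
  have hb := M.b_mem
  have h1 : 0 ≤ (1 - M.γ) * M.b := mul_nonneg M.one_sub_γ_pos.le hb.1.le
  have h2 : (1 - M.γ) * M.b ≤ 1 := by
    have := (le_div_iff₀ M.one_sub_γ_pos).1 hb.2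
    linarith
  rw [abs_le, g]
  constructor <;> linarith [h.1, h.2]

lemma measurable_saLaw {Ω : Type*} [MeasurableSpace Ω] {π μ : Ω → S → A → ℝ}
    (hπ : Measurable π) (hμ : Measurable μ) (t : ℕ) :
    ∀ s a, Measurable fun ω => M.saLaw (π ω) (μ ω) t s a := by
  have hc : ∀ {x : Ω → S → A → ℝ}, Measurable x → ∀ s a, Measurable fun ω => x ω s a :=
    fun hx s a => (measurable_pi_apply a).comp ((measurable_pi_apply s).comp hx)
  induction t with
  | zero => exact hc hμ
  | succ t ih =>
    intro s' a'
    simp only [saLaw]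
    exact Finset.measurable_sum _ fun s _ => Finset.measurable_sum _ fun a _ =>
      ((ih s a).mul_const _).mul (hc hπ s' a')

lemma measurable_Vρ {Ω : Type*} [MeasurableSpace Ω] {π : Ω → S → A → ℝ}
    (hπ : Measurable π) (hp : ∀ ω, IsPolicy (π ω)) (f : S → A → ℝ) :
    Measurable fun ω => M.Vρ (π ω) f := by
  have hc : ∀ s a, Measurable fun ω => π ω s a :=
    fun s a => (measurable_pi_apply a).comp ((measurable_pi_apply s).comp hπ)
  have hinit : Measurable fun ω => M.initLaw (π ω) :=
    measurable_pi_lambda _ fun s => measurable_pi_lambda _ fun a => (hc s a).const_mul _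
  have hocc : ∀ s a, Measurable fun ω => M.occupancy (π ω) (M.initLaw (π ω)) s a := by
    intro s a
    -- The occupancy is a pointwise limit of partial sums, each polynomial in the policy.
    refine measurable_of_tendsto_metrizable (f := fun n ω => ∑ t ∈ Finset.range n,
      M.γ ^ t * M.saLaw (π ω) (M.initLaw (π ω)) t s a) (fun n => ?_) ?_
    · exact Finset.measurable_sum _ fun t _ => (M.measurable_saLaw hπ hinit t s a).const_mul _
    · rw [tendsto_pi_nhds]
      exact fun ω => (M.summable_saLaw (hp ω) _ s a).hasSum.tendsto_sum_nat
  have : (fun ω => M.Vρ (π ω) f) =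
      fun ω => ∑ s, ∑ a, M.occupancy (π ω) (M.initLaw (π ω)) s a * f s a := by
    funext ω
    rw [M.Vρ_eq_discountedSum (hp ω), M.discountedSum_eq (hp ω)]
  rw [this]
  exact Finset.measurable_sum _ fun s _ => Finset.measurable_sum _ fun a _ =>
    (hocc s a).mul_const _

end Occupancy

end CMDP

/-- Divide by `s` and let `s → 0`. All first-order optimality conditions below are obtained this
way, without derivatives. -/
lemma le_zero_of_forall_mul_le_sq {a C : ℝ} (h : ∀ s : ℝ, 0 < s → s ≤ 1 → s * a ≤ s ^ 2 * C) :
    a ≤ 0 := by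
  by_contra! ha
  have hC : a ≤ C := by simpa using h 1 one_pos le_rfl
  have hC0 : 0 < C := ha.trans_le hC
  have hs : a / (2 * C) ≤ 1 := by rw [div_le_one (by positivity)]; linarith
  have h1 := h (a / (2 * C)) (by positivity) hs
  have h2 : (a / (2 * C)) ^ 2 * C = a / (2 * C) * (a / 2) := by field_simp
  rw [h2] at h1
  have := le_of_mul_le_mul_left h1 (by positivity)
  linarith

/-- Young's inequality stands in for Jensen: being linear in `x ^ 2`, the bound can be integrated
directly, and `θ` is tuned at the end. -/
lemma abs_le_sq_div_add {x θ : ℝ} (hθ : 0 < θ) : |x| ≤ x ^ 2 / (2 * θ) + θ / 2 := by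
  have h : x ^ 2 / (2 * θ) + θ / 2 - |x| = (|x| - θ) ^ 2 / (2 * θ) := by
    rw [← sq_abs]; field_simp; ring
  have : 0 ≤ (|x| - θ) ^ 2 / (2 * θ) := by positivity
  linarith

/-! ### KL divergence, mirror ascent and projected descent. -/

section KL

/-- A coordinatewise weak form of Pinsker's inequality, through the Hellinger distance `(√p - √q) ^
2`. The correction `-p + q` cancels when summed over two probability vectors. -/
lemma sq_sub_le_mul_log {p q : ℝ} (hp : 0 ≤ p) (hp1 : p ≤ 1) (hq : 0 < q) (hq1 : q ≤ 1) :
    (p - q) ^ 2 ≤ 4 * (p * Real.log (p / q) - p + q) := by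
  have h1 : (√p - √q) ^ 2 ≤ p * Real.log (p / q) - p + q := by
    rcases hp.eq_or_lt with rfl | hp
    · simp [Real.sq_sqrt hq.le]
    have hsp := Real.sqrt_pos.2 hp
    have hsq := Real.sqrt_pos.2 hq
    have hl : Real.log (√q / √p) ≤ √q / √p - 1 := Real.log_le_sub_one_of_pos (by positivity)
    have hlog : Real.log (p / q) = -2 * Real.log (√q / √p) := by
      rw [Real.log_div hp.ne' hq.ne', Real.log_div hsq.ne' hsp.ne', Real.log_sqrt hq.le,
        Real.log_sqrt hp.le]
      ring
    have h2 : p * (√q / √p) = √p * √q := by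
      rw [← mul_div_assoc, mul_div_right_comm, Real.div_sqrt]
    have h3 := mul_le_mul_of_nonneg_left hl hp.le
    rw [mul_sub, h2] at h3
    rw [hlog]
    nlinarith [Real.sq_sqrt hp.le, Real.sq_sqrt hq.le]
  have h2 : (p - q) ^ 2 = (√p - √q) ^ 2 * (√p + √q) ^ 2 := by
    have : p - q = (√p - √q) * (√p + √q) := by
      nlinarith [Real.sq_sqrt hp, Real.sq_sqrt hq.le]
    rw [this, mul_pow]
  have h3 : (√p + √q) ^ 2 ≤ 4 := by
    have := Real.sqrt_le_one.2 hp1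
    have := Real.sqrt_le_one.2 hq1
    nlinarith [Real.sqrt_nonneg p, Real.sqrt_nonneg q]
  rw [h2]
  nlinarith [sq_nonneg (√p - √q)]

variable {A : Type*} [Fintype A] {p q : A → ℝ}

lemma le_one_of_mem_stdSimplex (hp : p ∈ stdSimplex ℝ A) (a : A) : p a ≤ 1 := by
  rw [← hp.2]
  exact Finset.single_le_sum (fun a _ => hp.1 a) (Finset.mem_univ a)

lemma sum_sq_sub_le_klDivergence (hp : p ∈ stdSimplex ℝ A) (hq : q ∈ stdSimplex ℝ A)
    (hq0 : ∀ a, 0 < q a) : ∑ a, (p a - q a) ^ 2 ≤ 4 * klDivergence p q := by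
  have h : ∑ a, (p a - q a) ^ 2 ≤ ∑ a, 4 * (p a * Real.log (p a / q a) - p a + q a) :=
    Finset.sum_le_sum fun a _ => sq_sub_le_mul_log (hp.1 a) (le_one_of_mem_stdSimplex hp a)
      (hq0 a) (le_one_of_mem_stdSimplex hq a)
  rw [← Finset.mul_sum, Finset.sum_add_distrib, Finset.sum_sub_distrib, hp.2, hq.2] at h
  rw [klDivergence]
  linarith

lemma klDivergence_nonneg (hp : p ∈ stdSimplex ℝ A) (hq : q ∈ stdSimplex ℝ A)
    (hq0 : ∀ a, 0 < q a) : 0 ≤ klDivergence p q := by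
  have := sum_sq_sub_le_klDivergence hp hq hq0
  have : 0 ≤ ∑ a, (p a - q a) ^ 2 := Finset.sum_nonneg fun a _ => sq_nonneg _
  linarith

lemma klDivergence_eq (hq0 : ∀ a, 0 < q a) :
    klDivergence p q = ∑ a, (p a * Real.log (p a) - p a * Real.log (q a)) := by
  refine Finset.sum_congr rfl fun a _ => ?_
  rcases eq_or_ne (p a) 0 with h | h
  · simp [h]
  · rw [Real.log_div h (hq0 a).ne']; ring

lemma klDivergence_le_neg_log (hp : p ∈ stdSimplex ℝ A) {m : ℝ} (hm : 0 < m)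
    (hq : ∀ a, m ≤ q a) : klDivergence p q ≤ -Real.log m := by
  rw [klDivergence_eq fun a => hm.trans_le (hq a), ← one_mul (-Real.log m), ← hp.2,
    Finset.sum_mul]
  refine Finset.sum_le_sum fun a _ => ?_
  have h1 := Real.mul_log_nonpos (hp.1 a) (le_one_of_mem_stdSimplex hp a)
  have h2 := mul_le_mul_of_nonneg_left (Real.log_le_log hm (hq a)) (hp.1 a)
  linarith

/-- The mixture of `p` and the uniform distribution, with weights `1 - e` and `e`. -/
noncomputable def uniformMix (e : ℝ) (p : A → ℝ) (a : A) : ℝ := (1 - e) * p a + e / Fintype.card A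

lemma uniformMix_mem [Nonempty A] {e : ℝ} (he : 0 < e) (he1 : e < 1) (hp : p ∈ stdSimplex ℝ A) :
    uniformMix e p ∈ restrictedSimplex A e := by
  have hc : (0 : ℝ) < Fintype.card A := by exact_mod_cast Fintype.card_pos
  have h : ∀ a, e / Fintype.card A ≤ uniformMix e p a := fun a => by
    have := mul_nonneg (sub_nonneg.2 he1.le) (hp.1 a)
    rw [uniformMix]; linarith
  refine ⟨⟨fun a => le_trans (by positivity) (h a), ?_⟩, h⟩
  simp only [uniformMix, Finset.sum_add_distrib, ← Finset.mul_sum, hp.2, Finset.sum_const,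
    Finset.card_univ, nsmul_eq_mul]
  field_simp
  ring

lemma abs_sub_uniformMix_le [Nonempty A] {e : ℝ} (he : 0 < e) (hp : p ∈ stdSimplex ℝ A) :
    ∑ a, |p a - uniformMix e p a| ≤ 2 * e := by
  have hc : (0 : ℝ) < Fintype.card A := by exact_mod_cast Fintype.card_pos
  have h : ∀ a, |p a - uniformMix e p a| ≤ e * p a + e / Fintype.card A := fun a => by
    have := mul_nonneg he.le (hp.1 a)
    have : 0 < e / Fintype.card A := by positivity
    rw [uniformMix, abs_le]; constructor <;> linarith
  refine (Finset.sum_le_sum fun a _ => h a).trans (le_of_eq ?_)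
  simp only [Finset.sum_add_distrib, ← Finset.mul_sum, hp.2, Finset.sum_const,
    Finset.card_univ, nsmul_eq_mul]
  field_simp
  ring

lemma restrictedSimplex_pos [Nonempty A] {e : ℝ} (he : 0 < e) (hp : p ∈ restrictedSimplex A e)
    (a : A) : 0 < p a := by
  have hc : (0 : ℝ) < Fintype.card A := by exact_mod_cast Fintype.card_pos
  exact lt_of_lt_of_le (by positivity) (hp.2 a)

/-- Convexity of `x log x` splits the mixture. Its uniform part costs at most `e * log (n / e)`,
since `q ≥ e / n` and the uniform vector has nonpositive `x log x`. -/
lemma klDivergence_uniformMix_le [Nonempty A] {e : ℝ} (he : 0 < e) (he1 : e < 1)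
    (hp : p ∈ stdSimplex ℝ A) (hq : q ∈ restrictedSimplex A e) :
    klDivergence (uniformMix e p) q ≤ klDivergence p q + 2 * √(Fintype.card A) * √e := by
  have hc : (0 : ℝ) < Fintype.card A := by exact_mod_cast Fintype.card_pos
  have hc1 : (1 : ℝ) ≤ Fintype.card A := by exact_mod_cast Fintype.card_pos
  have hq0 := restrictedSimplex_pos he hq
  have hkl := klDivergence_nonneg hp hq.1 hq0
  set n : ℝ := (Fintype.card A : ℝ) with hn
  have hcoord : ∀ a, uniformMix e p a * Real.log (uniformMix e p a) -
      uniformMix e p a * Real.log (q a) ≤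
      (1 - e) * (p a * Real.log (p a) - p a * Real.log (q a)) + e / n * Real.log (n / e) := by
    intro a
    have hconv := Real.convexOn_mul_log.2 (Set.mem_Ici.2 (hp.1 a))
      (Set.mem_Ici.2 (by positivity : 0 ≤ 1 / n)) (sub_nonneg.2 he1.le) he.le (by ring)
    have hmix : (1 - e) • p a + e • (1 / n) = uniformMix e p a := by
      simp only [smul_eq_mul, uniformMix]; ring
    rw [hmix] at hconv
    simp only [smul_eq_mul] at hconv
    have hu : (1 / n) * Real.log (1 / n) ≤ 0 :=
      Real.mul_log_nonpos (by positivity) (by rw [div_le_one hc]; exact hc1)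
    have hlogq : -Real.log (q a) ≤ Real.log (n / e) := by
      rw [← Real.log_inv, ← inv_div e n, Real.log_inv, Real.log_inv]
      exact neg_le_neg (Real.log_le_log (by positivity) (hq.2 a))
    have h2 := mul_le_mul_of_nonneg_left hlogq (by positivity : 0 ≤ e / n)
    have h3 := mul_nonpos_of_nonneg_of_nonpos he.le hu
    have h4 : uniformMix e p a * Real.log (q a) =
      (1 - e) * (p a * Real.log (q a)) + e / n * Real.log (q a) := by rw [uniformMix]; ring
    rw [h4]
    linarith
  have hsum := Finset.sum_le_sum fun a (_ : a ∈ Finset.univ) => hcoord a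
  rw [← klDivergence_eq hq0, Finset.sum_add_distrib, ← Finset.mul_sum, ← klDivergence_eq hq0,
    Finset.sum_const, Finset.card_univ, nsmul_eq_mul, ← hn] at hsum
  -- Passing to `log √(n / e) ≤ √(n / e)` trades the logarithm for a half power, so no logarithm of
  -- `ε₀` enters the rates.
  have hlog : e * Real.log (n / e) ≤ 2 * √n * √e := by
    have h1 : Real.log (n / e) = 2 * Real.log (√(n / e)) := by
      rw [Real.log_sqrt (by positivity)]; ring
    have h2 : Real.log (√(n / e)) ≤ √(n / e) := Real.log_le_self (Real.sqrt_nonneg _)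
    have h3 : e * √(n / e) = √n * √e := by
      rw [Real.sqrt_div hc.le, ← mul_div_assoc, mul_comm e, mul_div_assoc, Real.div_sqrt]
    rw [h1]
    nlinarith
  have h5 : n * (e / n * Real.log (n / e)) = e * Real.log (n / e) := by field_simp
  have := mul_nonneg he.le hkl
  linarith

/-- One step of mirror ascent over the restricted simplex. -/
lemma mirror_ascent_step [Nonempty A] {e η B : ℝ} (he : 0 < e) (hη : 0 < η) {x p q ph : A → ℝ}
    (hp : p ∈ restrictedSimplex A e) (hq : q ∈ restrictedSimplex A e)
    (hph : ph ∈ restrictedSimplex A e)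
    (hmax : IsMaxOn (fun p : A → ℝ => ∑ a, p a * x a - 1 / η * klDivergence p q)
      (restrictedSimplex A e) p)
    (hx : ∀ a, |η * x a| ≤ B) (hB : B ≤ 1) :
    η * ∑ a, (ph a - q a) * x a ≤ klDivergence ph q - klDivergence ph p + B ^ 2 := by
  have hp0 := restrictedSimplex_pos he hp
  have hq0 := restrictedSimplex_pos he hq
  have hph0 := restrictedSimplex_pos he hph
  -- first-order optimality
  have hopt : η * ∑ a, (ph a - p a) * x a - ∑ a, (ph a - p a) * Real.log (p a / q a) ≤ 0 := by
    refine le_zero_of_forall_mul_le_sq (C := ∑ a, (ph a - p a) ^ 2 / p a) fun s hs hs1 => ?_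
    let ps : A → ℝ := fun a => p a + s * (ph a - p a)
    have hps0 : ∀ a, 0 < ps a := fun a => by
      have h1 := mul_pos hs (hph0 a)
      have h2 := mul_nonneg (sub_nonneg.2 hs1) (hp0 a).le
      simp only [ps]; linarith
    have hps : ps ∈ restrictedSimplex A e := by
      refine ⟨⟨fun a => (hps0 a).le, ?_⟩, fun a => ?_⟩
      · simp only [ps, Finset.sum_add_distrib, ← Finset.mul_sum, Finset.sum_sub_distrib,
          hp.1.2, hph.1.2]
        ring
      · have h1 := mul_le_mul_of_nonneg_left (hph.2 a) hs.le
        have h2 := mul_le_mul_of_nonneg_left (hp.2 a) (sub_nonneg.2 hs1)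
        simp only [ps]; linarith
    have hm : ∑ a, ps a * x a - 1 / η * klDivergence ps q ≤
        ∑ a, p a * x a - 1 / η * klDivergence p q := hmax hps
    -- Second-order upper bound for KL along the segment from `p` to `ph`; the remainder is a
    -- chi-square term, finite because `p` is positive.
    have hkl : klDivergence ps q ≤ klDivergence p q +
        s * ∑ a, (ph a - p a) * Real.log (p a / q a) + s ^ 2 * ∑ a, (ph a - p a) ^ 2 / p a := by
      have hcoord : ∀ a, ps a * Real.log (ps a / q a) ≤ p a * Real.log (p a / q a) +
          s * ((ph a - p a) * Real.log (p a / q a)) + s ^ 2 * ((ph a - p a) ^ 2 / p a) +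
          s * (ph a - p a) := by
        intro a
        have h1 : Real.log (ps a / q a) = Real.log (p a / q a) + Real.log (ps a / p a) := by
          rw [Real.log_div (hps0 a).ne' (hq0 a).ne', Real.log_div (hp0 a).ne' (hq0 a).ne',
            Real.log_div (hps0 a).ne' (hp0 a).ne']
          ring
        have h2 : Real.log (ps a / p a) ≤ ps a / p a - 1 :=
          Real.log_le_sub_one_of_pos (div_pos (hps0 a) (hp0 a))
        have h3 := mul_le_mul_of_nonneg_left h2 (hps0 a).le
        have h4 : ps a * (ps a / p a - 1) = s * (ph a - p a) + s ^ 2 * ((ph a - p a) ^ 2 / p a) := by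
          have := (hp0 a).ne'
          simp only [ps]; field_simp; ring
        rw [h1, mul_add]
        have h5 : ps a * Real.log (p a / q a) = p a * Real.log (p a / q a) +
          s * ((ph a - p a) * Real.log (p a / q a)) := by simp only [ps]; ring
        linarith
      have hsum := Finset.sum_le_sum fun a (_ : a ∈ Finset.univ) => hcoord a
      rw [Finset.sum_add_distrib, Finset.sum_add_distrib, Finset.sum_add_distrib, ← Finset.mul_sum,
        ← Finset.mul_sum, ← Finset.mul_sum, Finset.sum_sub_distrib, hp.1.2, hph.1.2] at hsum
      rw [klDivergence, klDivergence]
      linarith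
    have hlin : ∑ a, ps a * x a = ∑ a, p a * x a + s * ∑ a, (ph a - p a) * x a := by
      rw [Finset.mul_sum, ← Finset.sum_add_distrib]
      exact Finset.sum_congr rfl fun a _ => by simp only [ps]; ring
    rw [hlin] at hm
    have h6 : s * ∑ a, (ph a - p a) * x a ≤ 1 / η * (klDivergence ps q - klDivergence p q) := by
      rw [mul_sub]; linarith
    have h7 : η * (s * ∑ a, (ph a - p a) * x a) ≤ klDivergence ps q - klDivergence p q := by
      have := mul_le_mul_of_nonneg_left h6 hη.le
      rwa [← mul_assoc η (1 / η), mul_one_div_cancel hη.ne', one_mul] at this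
    linarith
  -- The three-point identity of the KL divergence.
  have hthree : ∑ a, (ph a - p a) * Real.log (p a / q a) =
      klDivergence ph q - klDivergence ph p - klDivergence p q := by
    rw [klDivergence_eq hq0, klDivergence_eq hp0, klDivergence_eq hq0, ← Finset.sum_sub_distrib,
      ← Finset.sum_sub_distrib]
    refine Finset.sum_congr rfl fun a _ => ?_
    rw [Real.log_div (hp0 a).ne' (hq0 a).ne']
    ring
  -- Stability of the step: the Gibbs variational bound in coordinates, via `log y ≤ y - 1`,
  -- followed by `exp y ≤ 1 + y + y ^ 2` for `|y| ≤ 1`.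
  have hsecond : η * ∑ a, (p a - q a) * x a - klDivergence p q ≤ B ^ 2 := by
    have hcoord : ∀ a, η * ((p a - q a) * x a) - p a * Real.log (p a / q a) ≤
        q a - p a + q a * B ^ 2 := by
      intro a
      have hy : |η * x a| ≤ 1 := (hx a).trans hB
      have h1 : Real.log (q a * Real.exp (η * x a) / p a) =
          η * x a - Real.log (p a / q a) := by
        rw [Real.log_div (mul_pos (hq0 a) (Real.exp_pos _)).ne' (hp0 a).ne',
          Real.log_mul (hq0 a).ne' (Real.exp_pos _).ne', Real.log_exp,
          Real.log_div (hp0 a).ne' (hq0 a).ne']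
        ring
      have h2 := Real.log_le_sub_one_of_pos
        (div_pos (mul_pos (hq0 a) (Real.exp_pos (η * x a))) (hp0 a))
      rw [h1] at h2
      have h3 := mul_le_mul_of_nonneg_left h2 (hp0 a).le
      have h4 : p a * (q a * Real.exp (η * x a) / p a - 1) = q a * Real.exp (η * x a) - p a := by
        have := (hp0 a).ne'
        field_simp
      have h5 := (abs_le.1 (Real.abs_exp_sub_one_sub_id_le hy)).2
      have h6 : (η * x a) ^ 2 ≤ B ^ 2 := by
        rw [← sq_abs]
        exact pow_le_pow_left₀ (abs_nonneg _) (hx a) 2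
      have h7 := mul_le_mul_of_nonneg_left (h5.trans h6) (hq0 a).le
      nlinarith
    have hsum := Finset.sum_le_sum fun a (_ : a ∈ Finset.univ) => hcoord a
    rw [Finset.sum_sub_distrib, Finset.sum_add_distrib, ← Finset.mul_sum, ← Finset.sum_mul,
      Finset.sum_sub_distrib, hp.1.2, hq.1.2] at hsum
    rw [klDivergence]
    linarith
  have hsplit : ∑ a, (ph a - q a) * x a =
      ∑ a, (ph a - p a) * x a + ∑ a, (p a - q a) * x a := by
    rw [← Finset.sum_add_distrib]
    exact Finset.sum_congr rfl fun a _ => by ring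
  rw [hsplit, mul_add]
  linarith

/-- One step of projected gradient descent on an interval. -/
lemma projected_descent_step {lo hi η y l l' ls : ℝ} (hη : 0 < η)
    (hl' : l' ∈ Set.Icc lo hi) (hls : ls ∈ Set.Icc lo hi)
    (hmin : IsMinOn (fun x : ℝ => x * y + 1 / (2 * η) * (x - l) ^ 2) (Set.Icc lo hi) l') :
    η * ((l - ls) * y) ≤ (l - ls) ^ 2 / 2 - (l' - ls) ^ 2 / 2 + η ^ 2 * y ^ 2 / 2 := by
  -- The variational inequality at the minimizer, tested with the segment towards `ls`.
  have hopt : η * ((l' - ls) * y) + (l' - ls) * (l' - l) ≤ 0 := by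
    refine le_zero_of_forall_mul_le_sq (C := (ls - l') ^ 2 / 2) fun s hs hs1 => ?_
    have hmem : l' + s * (ls - l') ∈ Set.Icc lo hi := by
      have h1 := mul_le_mul_of_nonneg_left hls.1 hs.le
      have h2 := mul_le_mul_of_nonneg_left hls.2 hs.le
      have h3 := mul_le_mul_of_nonneg_left hl'.1 (sub_nonneg.2 hs1)
      have h4 := mul_le_mul_of_nonneg_left hl'.2 (sub_nonneg.2 hs1)
      constructor <;> linarith
    have hm : l' * y + 1 / (2 * η) * (l' - l) ^ 2 ≤
        (l' + s * (ls - l')) * y + 1 / (2 * η) * (l' + s * (ls - l') - l) ^ 2 := hmin hmem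
    have h1 := mul_le_mul_of_nonneg_left hm hη.le
    have h2 : ∀ z : ℝ, η * (1 / (2 * η) * z) = z / 2 := fun z => by field_simp
    rw [mul_add, mul_add, h2, h2] at h1
    nlinarith
  nlinarith [sq_nonneg (η * y - (l - l'))]

end KL

namespace CMDP

/-! ### Transfer of the function approximation error. -/

section Errors

variable {S A : Type*} [Fintype S] [Fintype A] (M : CMDP S A)
  {d : ℕ} (φ : S → A → EuclideanSpace ℝ (Fin d))

lemma mul_sum_sq_le_covForm {D : S → ℝ} (hD : ∀ s, 0 ≤ D s) (s : S)
    (w : EuclideanSpace ℝ (Fin d)) (c : ℝ) (hc : 0 ≤ c) :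
    D s * ∑ a, c * (inner ℝ (φ s a) w) ^ 2 ≤ covForm φ (fun s _ => D s * c) w := by
  have h : covForm φ (fun s _ => D s * c) w = ∑ s, D s * ∑ a, c * (inner ℝ (φ s a) w) ^ 2 := by
    simp only [covForm, Finset.mul_sum, mul_assoc]
  rw [h]
  exact Finset.single_le_sum (f := fun s => D s * ∑ a, c * (inner ℝ (φ s a) w) ^ 2)
    (fun s _ => mul_nonneg (hD s) (Finset.sum_nonneg fun a _ => by positivity)) (Finset.mem_univ s)

lemma covForm_nonneg {μ : S → A → ℝ} (hμ : ∀ s a, 0 ≤ μ s a) (w : EuclideanSpace ℝ (Fin d)) :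
    0 ≤ covForm φ μ w :=
  Finset.sum_nonneg fun s _ => Finset.sum_nonneg fun a _ => mul_nonneg (hμ s a) (sq_nonneg _)

lemma covForm_le_of_relCondNumber {μ' μ : S → A → ℝ} (hμ : ∀ s a, 0 ≤ μ s a)
    (h : relCondNumber φ μ' μ < ⊤) (w : EuclideanSpace ℝ (Fin d)) :
    covForm φ μ' w ≤ (relCondNumber φ μ' μ).toReal * covForm φ μ w := by
  have h1 : ENNReal.ofReal (covForm φ μ' w) / ENNReal.ofReal (covForm φ μ w) ≤
      relCondNumber φ μ' μ :=
    le_iSup (fun w => ENNReal.ofReal (covForm φ μ' w) / ENNReal.ofReal (covForm φ μ w)) w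
  rw [ENNReal.div_le_iff_le_mul (Or.inr h.ne) (Or.inl ENNReal.ofReal_ne_top)] at h1
  have h2 := ENNReal.toReal_mono (ENNReal.mul_ne_top h.ne ENNReal.ofReal_ne_top) h1
  rw [ENNReal.toReal_mul, ENNReal.toReal_ofReal (covForm_nonneg φ hμ w)] at h2
  rw [ENNReal.toReal_ofReal'] at h2
  exact (le_max_left _ _).trans h2

/-- A finite relative condition number is bounded uniformly over the state distribution. -/
lemma exists_uniform_covForm_le {ν : S → A → ℝ} (hν : ∀ s a, 0 ≤ ν s a) :
    ∃ K : ℝ, 0 ≤ K ∧ ∀ D : S → ℝ, (∀ s, 0 ≤ D s) → ∑ s, D s = 1 →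
      relCondNumber φ (fun s _ => D s * (1 / Fintype.card A)) ν < ⊤ → ∀ w,
        covForm φ (fun s _ => D s * (1 / Fintype.card A)) w ≤ K * covForm φ ν w := by
  classical
  set c : ℝ := 1 / Fintype.card A with hc
  have hc0 : 0 ≤ c := by positivity
  -- Each state gets its own constant, chosen before `D`, if its quadratic form is dominated by that
  -- of `ν` at all. If not, a finite condition number forces `D s = 0`, and any constant will do.
  have hex : ∀ s, ∃ K : ℝ, 0 ≤ K ∧ ((∃ K' : ℝ, 0 ≤ K' ∧ ∀ w,
      ∑ a, c * (inner ℝ (φ s a) w) ^ 2 ≤ K' * covForm φ ν w) →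
      ∀ w, ∑ a, c * (inner ℝ (φ s a) w) ^ 2 ≤ K * covForm φ ν w) := by
    intro s
    by_cases h : ∃ K' : ℝ, 0 ≤ K' ∧ ∀ w, ∑ a, c * (inner ℝ (φ s a) w) ^ 2 ≤ K' * covForm φ ν w
    · obtain ⟨K', h0, h1⟩ := h
      exact ⟨K', h0, fun _ => h1⟩
    · exact ⟨0, le_rfl, fun h' => absurd h' h⟩
  choose K hK0 hK using hex
  refine ⟨∑ s, K s, Finset.sum_nonneg fun s _ => hK0 s, fun D hD hD1 hrel w => ?_⟩
  have hcov := covForm_nonneg φ hν w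
  have h1 : ∀ s, D s * ∑ a, c * (inner ℝ (φ s a) w) ^ 2 ≤ K s * covForm φ ν w := by
    intro s
    rcases (hD s).eq_or_lt with h0 | h0
    · rw [← h0, zero_mul]
      exact mul_nonneg (hK0 s) hcov
    · have hs := hK s ⟨(relCondNumber φ (fun s _ => D s * c) ν).toReal / D s,
        div_nonneg ENNReal.toReal_nonneg h0.le, fun w => by
          rw [div_mul_eq_mul_div, le_div_iff₀ h0, mul_comm]
          exact (mul_sum_sq_le_covForm φ hD s w c hc0).trans
            (covForm_le_of_relCondNumber φ hν hrel w)⟩ w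
      have hD1s : D s ≤ 1 := hD1 ▸ Finset.single_le_sum (fun s _ => hD s) (Finset.mem_univ s)
      refine le_trans ?_ hs
      exact mul_le_of_le_one_left (Finset.sum_nonneg fun a _ => by positivity) hD1s
  calc covForm φ (fun s _ => D s * c) w = ∑ s, D s * ∑ a, c * (inner ℝ (φ s a) w) ^ 2 := by
        simp only [covForm, Finset.mul_sum, mul_assoc]
    _ ≤ ∑ s, K s * covForm φ ν w := Finset.sum_le_sum fun s _ => h1 s
    _ = _ := by rw [Finset.sum_mul]

/-- The excess error of `w` over a minimizer `w₀` is the quadratic form at `w - w₀`. -/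
lemma approxError_sub_of_min (τ : ℝ) (π : S → A → ℝ) (lam : ℝ) {μ : S → A → ℝ}
    {w₀ : EuclideanSpace ℝ (Fin d)}
    (hmin : ∀ v, M.approxError φ τ π lam μ w₀ ≤ M.approxError φ τ π lam μ v)
    (w : EuclideanSpace ℝ (Fin d)) :
    M.approxError φ τ π lam μ w - M.approxError φ τ π lam μ w₀ = covForm φ μ (w - w₀) := by
  set B : ℝ := ∑ s, ∑ a, μ s a *
    (2 * inner ℝ (φ s a) (w - w₀) * (inner ℝ (φ s a) w₀ - M.regQ τ π lam s a)) with hB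
  have hexp : ∀ t : ℝ, M.approxError φ τ π lam μ (w₀ + t • (w - w₀)) =
      M.approxError φ τ π lam μ w₀ + t * B + t ^ 2 * covForm φ μ (w - w₀) := by
    intro t
    simp only [approxError, covForm, hB, Finset.mul_sum, ← Finset.sum_add_distrib]
    refine Finset.sum_congr rfl fun s _ => Finset.sum_congr rfl fun a _ => ?_
    rw [inner_add_right, inner_smul_right]
    ring
  -- The linear coefficient vanishes because `w₀` is minimal in both directions along the line
  -- through `w`.
  have h0 : B ≤ 0 := le_zero_of_forall_mul_le_sq (C := covForm φ μ (w - w₀)) fun s _ _ => by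
    have := hmin (w₀ + (-s) • (w - w₀))
    rw [hexp] at this
    nlinarith
  have h0' : -B ≤ 0 := le_zero_of_forall_mul_le_sq (C := covForm φ μ (w - w₀)) fun s _ _ => by
    have := hmin (w₀ + s • (w - w₀))
    rw [hexp] at this
    nlinarith
  have h1 := hexp 1
  rw [one_smul, add_sub_cancel] at h1
  rw [h1]
  linarith

lemma approxError_le_two_mul (τ : ℝ) (π : S → A → ℝ) (lam : ℝ) {μ : S → A → ℝ}
    (hμ : ∀ s a, 0 ≤ μ s a) (w w₀ : EuclideanSpace ℝ (Fin d)) :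
    M.approxError φ τ π lam μ w ≤
      2 * covForm φ μ (w - w₀) + 2 * M.approxError φ τ π lam μ w₀ := by
  simp only [approxError, covForm, Finset.mul_sum, ← Finset.sum_add_distrib]
  refine Finset.sum_le_sum fun s _ => Finset.sum_le_sum fun a _ => ?_
  rw [inner_sub_right]
  nlinarith [mul_nonneg (hμ s a)
    (sq_nonneg (inner ℝ (φ s a) w - 2 * inner ℝ (φ s a) w₀ + M.regQ τ π lam s a))]

/-- Only the time-zero term of the discounted sum is kept. -/
lemma one_sub_γ_mul_le_saVisit {π ν : S → A → ℝ} (hπ : IsPolicy π) (hν : ∀ s a, 0 ≤ ν s a)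
    (s : S) (a : A) : (1 - M.γ) * ν s a ≤ M.saVisit π ν s a := by
  classical
  refine mul_le_mul_of_nonneg_left ?_ M.one_sub_γ_pos.le
  have hpair : ∀ s₀ a₀ (s : S) (a : A), (0 : ℝ) ≤ startPair s₀ a₀ s a := fun s₀ a₀ s a => by
    unfold startPair; split_ifs <;> simp
  have hterm : ∀ s₀ a₀, 0 ≤ ν s₀ a₀ * M.occupancy π (startPair s₀ a₀) s a := fun s₀ a₀ =>
    mul_nonneg (hν s₀ a₀) (M.occupancy_nonneg hπ (hpair s₀ a₀) s a)
  calc ν s a ≤ ν s a * M.occupancy π (startPair s a) s a := by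
        have h := M.le_occupancy hπ (hpair s a) s a
        simp only [startPair, and_self, if_true] at h
        exact le_mul_of_one_le_right (hν s a) h
    _ ≤ ∑ a₀, ν s a₀ * M.occupancy π (startPair s a₀) s a :=
        Finset.single_le_sum (f := fun a₀ => ν s a₀ * M.occupancy π (startPair s a₀) s a)
          (fun a₀ _ => hterm s a₀) (Finset.mem_univ a)
    _ ≤ ∑ s₀, ∑ a₀, ν s₀ a₀ * M.occupancy π (startPair s₀ a₀) s a :=
        Finset.single_le_sum
          (f := fun s₀ => ∑ a₀, ν s₀ a₀ * M.occupancy π (startPair s₀ a₀) s a)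
          (fun s₀ _ => Finset.sum_nonneg fun a₀ _ => hterm s₀ a₀) (Finset.mem_univ s)

lemma one_sub_γ_mul_covForm_le {π ν : S → A → ℝ} (hπ : IsPolicy π) (hν : ∀ s a, 0 ≤ ν s a)
    (w : EuclideanSpace ℝ (Fin d)) :
    (1 - M.γ) * covForm φ ν w ≤ covForm φ (M.saVisit π ν) w := by
  simp only [covForm, Finset.mul_sum, ← mul_assoc]
  exact Finset.sum_le_sum fun s _ => Finset.sum_le_sum fun a _ =>
    mul_le_mul_of_nonneg_right (M.one_sub_γ_mul_le_saVisit hπ hν s a) (sq_nonneg _)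

end Errors

/-! ### The regularized Lagrangian and its saddle point. -/

section Saddle

variable {S A : Type*} [Fintype S] [Fintype A] (M : CMDP S A)

lemma regLagrangian_eq {π : S → A → ℝ} (hπ : IsPolicy π) (τ lam : ℝ) :
    M.regLagrangian τ π lam =
      M.Vρ π M.r + lam * M.Vρ π M.g + τ * (M.entropy π + lam ^ 2 / 2) := by
  rw [regLagrangian, M.Vρ_add hπ M.r (fun s a => lam * M.g s a), M.Vρ_smul hπ]

/-- The performance difference lemma is applied with the reward `-log π` frozen at `π`. Under `π'`
the true entropy reward is `-log π'`, and the discrepancy is exactly a KL divergence: this is the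
strong concavity. -/
lemma regLagrangian_sub {π π' : S → A → ℝ} (hπ : IsPolicy π) (hπ0 : ∀ s a, 0 < π s a)
    (hπ' : IsPolicy π') (τ lam : ℝ) :
    (1 - M.γ) * (M.regLagrangian τ π' lam - M.regLagrangian τ π lam) =
      ∑ s, M.stateVisit π' s * ∑ a, (π' s a - π s a) * M.regQ τ π lam s a -
        τ * ∑ s, M.stateVisit π' s * klDivergence (π' s) (π s) := by
  have hkl : ∑ s, M.stateVisit π' s * klDivergence (π' s) (π s) =
      (1 - M.γ) * (M.Vρ π' (fun s a => -Real.log (π s a)) - M.entropy π') := by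
    rw [mul_sub, entropy, M.one_sub_γ_mul_Vρ hπ', M.one_sub_γ_mul_Vρ hπ', ← Finset.sum_sub_distrib]
    refine Finset.sum_congr rfl fun s _ => ?_
    rw [← mul_sub, ← Finset.sum_sub_distrib, klDivergence_eq (hπ0 s)]
    congr 1
    exact Finset.sum_congr rfl fun a _ => by ring
  rw [hkl]
  simp only [regQ]
  rw [← M.performance_difference hπ hπ']
  rw [M.Vρ_add hπ (fun s a => M.r s a + lam * M.g s a) (fun s a => τ * -Real.log (π s a)),
    M.Vρ_add hπ' (fun s a => M.r s a + lam * M.g s a) (fun s a => τ * -Real.log (π s a)),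
    M.Vρ_smul hπ τ (fun s a => -Real.log (π s a)), M.Vρ_smul hπ' τ (fun s a => -Real.log (π s a)),
    regLagrangian, regLagrangian]
  rw [show M.entropy π = M.Vρ π (fun s a => -Real.log (π s a)) from rfl]
  ring

variable {M} {ξ τ : ℝ} {πτ : S → A → ℝ} {lamτ : ℝ}

/-- Strong concavity-convexity of the regularized Lagrangian at its saddle point. -/
lemma IsRegSaddle.gap (h : M.IsRegSaddle ξ τ πτ lamτ) {π : S → A → ℝ} (hπ : IsPolicy π)
    (hπ0 : ∀ s a, 0 < π s a) {lam : ℝ} (hlam : lam ∈ M.dualSet ξ) :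
    τ * (1 / (1 - M.γ) * ∑ s, M.stateVisit πτ s * klDivergence (πτ s) (π s) +
        (lam - lamτ) ^ 2 / 2) ≤
      1 / (1 - M.γ) * ∑ s, M.stateVisit πτ s * ∑ a, (πτ s a - π s a) * M.regQ τ π lam s a +
        (lam - lamτ) * (M.Vρ π M.g + τ * lam) := by
  obtain ⟨hp, -, hmax, hmin⟩ := h
  have h1 := hmax π hπ
  -- Together, `h1` and `h2` compare the two crossed points: `L(π, lamτ) ≤ L(πτ, lam)`. Passing
  -- through `L(π, lam)` gives the primal and the dual part by exact expansion.
  have h2 := hmin lam hlam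
  have h3 := M.regLagrangian_sub hπ hπ0 hp τ lam
  rw [M.regLagrangian_eq hπ τ lamτ] at h1
  have h4 := M.regLagrangian_eq hπ τ lam
  have h5 : M.regLagrangian τ πτ lam - M.regLagrangian τ π lam = 1 / (1 - M.γ) *
      ∑ s, M.stateVisit πτ s * ∑ a, (πτ s a - π s a) * M.regQ τ π lam s a -
      τ * (1 / (1 - M.γ) * ∑ s, M.stateVisit πτ s * klDivergence (πτ s) (π s)) := by
    have := M.one_sub_γ_pos.ne'
    rw [eq_comm, ← mul_right_inj' this, h3]
    field_simp
  nlinarith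

lemma entropy_nonneg {π : S → A → ℝ} (hπ : IsPolicy π) : 0 ≤ M.entropy π := by
  have h : 0 ≤ (1 - M.γ) * M.entropy π := by
    rw [entropy, M.one_sub_γ_mul_Vρ hπ]
    refine Finset.sum_nonneg fun s _ => mul_nonneg (M.stateVisit_nonneg hπ s) ?_
    refine Finset.sum_nonneg fun a _ => ?_
    have := Real.mul_log_nonpos ((hπ s).1 a) (le_one_of_mem_stdSimplex (hπ s) a)
    linarith
  exact nonneg_of_mul_nonneg_right h M.one_sub_γ_pos

/-- The bound `-x log x ≤ 1` per action gives `|A|` instead of `log |A|`; any bound independent of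
the policy serves. -/
lemma entropy_le {π : S → A → ℝ} (hπ : IsPolicy π) :
    M.entropy π ≤ Fintype.card A / (1 - M.γ) := by
  rw [le_div_iff₀ M.one_sub_γ_pos, mul_comm, entropy, M.one_sub_γ_mul_Vρ hπ,
    ← one_mul (Fintype.card A : ℝ), ← M.sum_stateVisit hπ, Finset.sum_mul]
  refine Finset.sum_le_sum fun s _ => mul_le_mul_of_nonneg_left ?_ (M.stateVisit_nonneg hπ s)
  have h : ∀ a, π s a * -Real.log (π s a) ≤ 1 := by
    intro a
    rcases ((hπ s).1 a).eq_or_lt with h | h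
    · simp [← h]
    · have h1 := Real.one_sub_inv_le_log_of_pos h
      have h2 : π s a * (1 - (π s a)⁻¹) ≤ π s a * Real.log (π s a) :=
        mul_le_mul_of_nonneg_left h1 h.le
      rw [mul_sub, mul_inv_cancel₀ h.ne'] at h2
      linarith
  simpa using Finset.sum_le_sum fun a (_ : a ∈ Finset.univ) => h a

/-- The optimality gap of the regularized saddle point. -/
lemma IsRegSaddle.optimality_gap (h : M.IsRegSaddle ξ τ πτ lamτ) (hξ : 0 < ξ) (hτ : 0 < τ)
    {π : S → A → ℝ} (hπ : IsPolicy π) (hg : 0 ≤ M.Vρ π M.g) :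
    M.Vρ π M.r - M.Vρ πτ M.r ≤ τ * (Fintype.card A / (1 - M.γ)) := by
  obtain ⟨hp, hl, hmax, hmin⟩ := h
  have h0 : (0 : ℝ) ∈ M.dualSet ξ :=
    ⟨le_rfl, by have := M.one_sub_γ_pos; positivity⟩
  -- The crossed points are now `(π, lamτ)` and `(πτ, 0)`. The dual value `0` removes the constraint
  -- term of `πτ`, and feasibility gives that of `π` a sign.
  have h1 := (hmax π hπ).trans (hmin 0 h0)
  rw [M.regLagrangian_eq hπ, M.regLagrangian_eq hp] at h1
  have h2 := mul_nonneg hl.1 hg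
  have h3 := mul_nonneg hτ.le (entropy_nonneg (M := M) hπ)
  have h4 := mul_le_mul_of_nonneg_left (entropy_le (M := M) hp) hτ.le
  nlinarith [mul_nonneg hτ.le (sq_nonneg lamτ)]

/-- The constraint violation of the regularized saddle point. -/
lemma IsRegSaddle.violation (h : M.IsRegSaddle ξ τ πτ lamτ) (hξ : 0 < ξ) (hτ : 0 < τ)
    (hfeas : M.Feasible ξ) :
    -M.Vρ πτ M.g ≤ τ * (1 / ((1 - M.γ) * ξ) + ξ * Fintype.card A) := by
  obtain ⟨hp, hl, hmax, hmin⟩ := h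
  have hm := M.one_sub_γ_pos
  have hLpos : 0 < 1 / ((1 - M.γ) * ξ) := by positivity
  -- At the upper end of `Λ`, the strictly feasible policy is the comparator: the multiplier times
  -- its slack is at least `1 / (1 - γ)`, which exceeds any reward value. Below that end, optimality
  -- in `lam` gives `V_g + τ * lamτ ≥ 0`. The bound adds the two cases.
  rcases hl.2.eq_or_lt with heq | hlt
  · obtain ⟨πb, hπb, hgb⟩ := hfeas
    have h1 := hmax πb hπb
    rw [M.regLagrangian_eq hπb, M.regLagrangian_eq hp, heq] at h1
    have h2 : 1 / (1 - M.γ) ≤ 1 / ((1 - M.γ) * ξ) * M.Vρ πb M.g := by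
      have := mul_le_mul_of_nonneg_left hgb hLpos.le
      have h3 : 1 / ((1 - M.γ) * ξ) * ξ = 1 / (1 - M.γ) := by field_simp
      linarith
    have h3 := mul_nonneg hτ.le (entropy_nonneg (M := M) hπb)
    have h4 := mul_le_mul_of_nonneg_left (entropy_le (M := M) hp) hτ.le
    have h5 := (abs_le.1 (M.abs_Vρ_le hp M.abs_r_le)).2
    have h6 : 0 ≤ M.Vρ πb M.r := by
      have : 0 ≤ (1 - M.γ) * M.Vρ πb M.r := by
        rw [M.one_sub_γ_mul_Vρ hπb]
        exact Finset.sum_nonneg fun s _ => mul_nonneg (M.stateVisit_nonneg hπb s)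
          (Finset.sum_nonneg fun a _ => mul_nonneg ((hπb s).1 a) (M.r_mem s a).1)
      exact nonneg_of_mul_nonneg_right this hm
    have h7 : 1 / ((1 - M.γ) * ξ) * -M.Vρ πτ M.g ≤ τ * (Fintype.card A / (1 - M.γ)) := by
      linarith
    have h8 := mul_le_mul_of_nonneg_left h7 (mul_pos hm hξ).le
    have h9 : (1 - M.γ) * ξ * (1 / ((1 - M.γ) * ξ) * -M.Vρ πτ M.g) = -M.Vρ πτ M.g := by
      field_simp
    have h10 : (1 - M.γ) * ξ * (τ * (Fintype.card A / (1 - M.γ))) = τ * (ξ * Fintype.card A) := by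
      field_simp
    rw [h9, h10] at h8
    have := mul_pos hτ hLpos
    linarith
  · set L := 1 / ((1 - M.γ) * ξ) with hL
    have h1 : -(M.Vρ πτ M.g + τ * lamτ) * (L - lamτ) ≤ 0 := by
      refine le_zero_of_forall_mul_le_sq (C := τ * (L - lamτ) ^ 2 / 2) fun s hs hs1 => ?_
      have hmem : lamτ + s * (L - lamτ) ∈ M.dualSet ξ := by
        have h2 := mul_nonneg hs.le (sub_nonneg.2 hlt.le)
        have h3 := mul_le_mul_of_nonneg_right hs1 (sub_nonneg.2 hlt.le)
        refine ⟨by linarith [hl.1], ?_⟩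
        rw [← hL]
        linarith
      have h2 := hmin _ hmem
      rw [M.regLagrangian_eq hp, M.regLagrangian_eq hp] at h2
      nlinarith
    have h2 : 0 ≤ M.Vρ πτ M.g + τ * lamτ := by
      by_contra! h3
      have := mul_pos (neg_pos.2 h3) (sub_pos.2 hlt)
      linarith
    have h3 := mul_le_mul_of_nonneg_left hlt.le hτ.le
    have h4 : 0 ≤ τ * (ξ * Fintype.card A) := by positivity
    linarith

end Saddle

/-! ### The Lyapunov function and its one-step contraction. -/

section Potential

variable {S A : Type*} [Fintype S] [Fintype A] (M : CMDP S A)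

/-- The Lyapunov function of the primal-dual iteration relative to a saddle point, whose policy is
mixed with the uniform one. -/
noncomputable def potential (ε₀ : ℝ) (πτ : S → A → ℝ) (lamτ : ℝ) (π : S → A → ℝ) (lam : ℝ) : ℝ :=
  1 / (1 - M.γ) * ∑ s, M.stateVisit πτ s * klDivergence (uniformMix ε₀ (πτ s)) (π s) +
    (lam - lamτ) ^ 2 / 2

variable {M} {ξ τ : ℝ} {πτ : S → A → ℝ} {lamτ : ℝ}
  {d : ℕ} {φ : S → A → EuclideanSpace ℝ (Fin d)}

/-- The comparator of the mirror step must lie in the restricted simplex, where `πτ` need not be;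
hence the mixture. Mixing is paid twice: `2 * ε₀ * W` in the linear term, and a multiple of `√ε₀`
when `IsRegSaddle.gap`, which speaks of the unmixed KL, is turned into contraction of the mixed one.
-/
lemma potential_step [Nonempty A] (h : M.IsRegSaddle ξ τ πτ lamτ) {ε₀ η W Y θ : ℝ}
    (hε₀ : 0 < ε₀) (hε₁ : ε₀ < 1) (hη : 0 < η) (hτ : 0 < τ) (hθ : 0 < θ)
    {π π' : S → A → ℝ} {lam lam' : ℝ} {w : EuclideanSpace ℝ (Fin d)}
    (hφ : ∀ s a, ‖φ s a‖ ≤ 1) (hw : ‖w‖ ≤ W) (hηW : η * W ≤ 1)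
    (hπ : ∀ s, π s ∈ restrictedSimplex A ε₀) (hπ' : ∀ s, π' s ∈ restrictedSimplex A ε₀)
    (hmax : ∀ s, IsMaxOn
      (fun p : A → ℝ => ∑ a, p a * inner ℝ (φ s a) w - 1 / η * klDivergence p (π s))
      (restrictedSimplex A ε₀) (π' s))
    (hlam : lam ∈ M.dualSet ξ) (hlam' : lam' ∈ M.dualSet ξ)
    (hmin : IsMinOn (fun l : ℝ => l * (M.Vρ π M.g + τ * lam) + 1 / (2 * η) * (l - lam) ^ 2)
      (M.dualSet ξ) lam')
    (hY : |M.Vρ π M.g + τ * lam| ≤ Y) :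
    M.potential ε₀ πτ lamτ π' lam' ≤ (1 - η * τ) * M.potential ε₀ πτ lamτ π lam +
      (η * τ * (1 / (1 - M.γ)) * (2 * √(Fintype.card A) * √ε₀) +
        η / (1 - M.γ) * (2 * ε₀ * W) + (η * W) ^ 2 / (1 - M.γ) + η ^ 2 * Y ^ 2 / 2) +
      η / (1 - M.γ) * Fintype.card A *
        (M.approxError φ τ π lam (M.transferLaw πτ) w / (2 * θ) + θ / 2) := by
  have hm := M.one_sub_γ_pos
  have hc : (0 : ℝ) < Fintype.card A := by exact_mod_cast Fintype.card_pos
  have hp := h.1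
  have hpol : IsPolicy π := fun s => (hπ s).1
  have hpos : ∀ s a, 0 < π s a := fun s => restrictedSimplex_pos hε₀ (hπ s)
  have hW : 0 ≤ W := (norm_nonneg w).trans hw
  have hx : ∀ s a, |inner ℝ (φ s a) w| ≤ W := fun s a => by
    refine (abs_real_inner_le_norm _ _).trans ?_
    calc ‖φ s a‖ * ‖w‖ ≤ 1 * W := mul_le_mul (hφ s a) hw (norm_nonneg _) zero_le_one
      _ = W := one_mul W
  set D := M.stateVisit πτ with hDdef
  have hD : ∀ s, 0 ≤ D s := M.stateVisit_nonneg hp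
  have hD1 : ∑ s, D s = 1 := M.sum_stateVisit hp
  have hph : ∀ s, uniformMix ε₀ (πτ s) ∈ restrictedSimplex A ε₀ := fun s =>
    uniformMix_mem hε₀ hε₁ (hp s)
  -- the inner products with the exact action values
  have hinner : ∀ s, η * ∑ a, (πτ s a - π s a) * M.regQ τ π lam s a ≤
      klDivergence (uniformMix ε₀ (πτ s)) (π s) - klDivergence (uniformMix ε₀ (πτ s)) (π' s) +
        (η * W) ^ 2 + η * (2 * ε₀ * W) +
        η * ∑ a, ((inner ℝ (φ s a) w - M.regQ τ π lam s a) ^ 2 / (2 * θ) + θ / 2) := by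
    intro s
    have h1 := mirror_ascent_step hε₀ hη (hπ' s) (hπ s) (hph s) (hmax s) (B := η * W)
      (fun a => by
        rw [abs_mul, abs_of_pos hη]
        exact mul_le_mul_of_nonneg_left (hx s a) hη.le) hηW
    have h2 : ∑ a, (πτ s a - uniformMix ε₀ (πτ s) a) * inner ℝ (φ s a) w ≤ 2 * ε₀ * W := by
      refine le_trans (Finset.sum_le_sum fun a _ => ?_)
        ((Finset.sum_mul _ _ _).symm.le.trans
          (mul_le_mul_of_nonneg_right (abs_sub_uniformMix_le hε₀ (hp s)) hW))
      refine (le_abs_self _).trans ?_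
      rw [abs_mul]
      exact mul_le_mul_of_nonneg_left (hx s a) (abs_nonneg _)
    have h3 : ∑ a, (πτ s a - π s a) * (M.regQ τ π lam s a - inner ℝ (φ s a) w) ≤
        ∑ a, ((inner ℝ (φ s a) w - M.regQ τ π lam s a) ^ 2 / (2 * θ) + θ / 2) := by
      refine Finset.sum_le_sum fun a _ => ?_
      have h4 : |πτ s a - π s a| ≤ 1 := by
        have := le_one_of_mem_stdSimplex (hp s) a
        have := le_one_of_mem_stdSimplex (hpol s) a
        have := (hp s).1 a
        have := (hpol s).1 a
        rw [abs_le]; constructor <;> linarith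
      refine le_trans ?_ (abs_le_sq_div_add hθ)
      refine (le_abs_self _).trans ?_
      rw [abs_mul, abs_sub_comm (M.regQ τ π lam s a)]
      exact mul_le_of_le_one_left (abs_nonneg _) h4
    have h5 : ∑ a, (πτ s a - π s a) * M.regQ τ π lam s a =
        ∑ a, (uniformMix ε₀ (πτ s) a - π s a) * inner ℝ (φ s a) w +
        ∑ a, (πτ s a - uniformMix ε₀ (πτ s) a) * inner ℝ (φ s a) w +
        ∑ a, (πτ s a - π s a) * (M.regQ τ π lam s a - inner ℝ (φ s a) w) := by
      rw [← Finset.sum_add_distrib, ← Finset.sum_add_distrib]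
      exact Finset.sum_congr rfl fun a _ => by ring
    rw [h5, mul_add, mul_add]
    have h6 := mul_le_mul_of_nonneg_left h2 hη.le
    have h7 := mul_le_mul_of_nonneg_left h3 hη.le
    linarith
  have hprimal : η * ∑ s, D s * ∑ a, (πτ s a - π s a) * M.regQ τ π lam s a ≤
      ∑ s, D s * klDivergence (uniformMix ε₀ (πτ s)) (π s) -
      ∑ s, D s * klDivergence (uniformMix ε₀ (πτ s)) (π' s) + (η * W) ^ 2 + η * (2 * ε₀ * W) +
      η * (Fintype.card A *
        (M.approxError φ τ π lam (M.transferLaw πτ) w / (2 * θ) + θ / 2)) := by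
    have h1 := Finset.sum_le_sum fun s (_ : s ∈ Finset.univ) =>
      mul_le_mul_of_nonneg_left (hinner s) (hD s)
    -- Actions are uniform under `transferLaw`, so the unweighted sum over actions costs a factor
    -- `|A|`.
    have h2 : M.approxError φ τ π lam (M.transferLaw πτ) w =
        1 / Fintype.card A * ∑ s, D s * ∑ a, (inner ℝ (φ s a) w - M.regQ τ π lam s a) ^ 2 := by
      simp only [approxError, transferLaw, Finset.mul_sum, hDdef]
      exact Finset.sum_congr rfl fun s _ => Finset.sum_congr rfl fun a _ => by ring
    have h3 : ∑ s, D s *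
          ∑ a, ((inner ℝ (φ s a) w - M.regQ τ π lam s a) ^ 2 / (2 * θ) + θ / 2) =
        Fintype.card A * (M.approxError φ τ π lam (M.transferLaw πτ) w / (2 * θ) + θ / 2) := by
      rw [h2]
      simp only [Finset.sum_add_distrib, mul_add, ← Finset.sum_div, ← Finset.sum_mul,
        ← mul_div_assoc, Finset.sum_const, Finset.card_univ, nsmul_eq_mul, hD1]
      field_simp
    rw [← h3]
    have h4 : η * ∑ s, D s * ∑ a, (πτ s a - π s a) * M.regQ τ π lam s a =
        ∑ s, D s * (η * ∑ a, (πτ s a - π s a) * M.regQ τ π lam s a) := by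
      rw [Finset.mul_sum]
      exact Finset.sum_congr rfl fun s _ => by ring
    rw [h4]
    obtain ⟨Z, hZ⟩ : ∃ Z : S → ℝ, ∀ s, Z s =
      ∑ a, ((inner ℝ (φ s a) w - M.regQ τ π lam s a) ^ 2 / (2 * θ) + θ / 2) := ⟨_, fun s => rfl⟩
    simp only [← hZ] at h1 ⊢
    refine h1.trans (le_of_eq ?_)
    simp only [mul_add, mul_sub, Finset.sum_add_distrib, Finset.sum_sub_distrib, ← Finset.sum_mul,
      hD1, one_mul, Finset.mul_sum, mul_left_comm η]
  have hdual := projected_descent_step hη hlam' h.2.1 hmin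
  have hY2 : (M.Vρ π M.g + τ * lam) ^ 2 ≤ Y ^ 2 := by
    rw [← sq_abs]
    exact pow_le_pow_left₀ (abs_nonneg _) hY 2
  have hmix : ∑ s, D s * klDivergence (uniformMix ε₀ (πτ s)) (π s) ≤
      ∑ s, D s * klDivergence (πτ s) (π s) + 2 * √(Fintype.card A) * √ε₀ := by
    have h1 := Finset.sum_le_sum fun s (_ : s ∈ Finset.univ) =>
      mul_le_mul_of_nonneg_left (klDivergence_uniformMix_le hε₀ hε₁ (hp s) (hπ s)) (hD s)
    simp only [mul_add, Finset.sum_add_distrib, ← Finset.sum_mul, hD1, one_mul] at h1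
    exact h1
  have hgap := mul_le_mul_of_nonneg_left (h.gap hpol hpos hlam) hη.le
  rw [potential, potential, ← hDdef]
  rw [← hDdef] at hgap
  set i := 1 / (1 - M.γ) with hi
  have hi0 : 0 < i := by positivity
  have hηm : η / (1 - M.γ) = i * η := by rw [hi]; ring
  have hηm2 : (η * W) ^ 2 / (1 - M.γ) = i * (η * W) ^ 2 := by rw [hi]; ring
  rw [hηm, hηm2]
  have h1 := mul_le_mul_of_nonneg_left hprimal hi0.le
  have h2 := mul_le_mul_of_nonneg_left hmix (mul_pos (mul_pos hη hτ) hi0).le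
  have h3 := mul_le_mul_of_nonneg_left hY2 (sq_nonneg η)
  generalize ∑ s, D s * klDivergence (uniformMix ε₀ (πτ s)) (π s) = X1 at *
  generalize ∑ s, D s * klDivergence (uniformMix ε₀ (πτ s)) (π' s) = X2 at *
  generalize ∑ s, D s * klDivergence (πτ s) (π s) = X3 at *
  generalize ∑ s, D s * ∑ a, (πτ s a - π s a) * M.regQ τ π lam s a = X4 at *
  generalize M.approxError φ τ π lam (M.transferLaw πτ) w / (2 * θ) + θ / 2 = X5 at *
  nlinarith

/-- Closeness in potential controls the difference of values. -/
lemma abs_Vρ_sub_le_potential [Nonempty A] (hp : IsPolicy πτ) {ε₀ θ : ℝ} (hε₀ : 0 < ε₀)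
    (hε₁ : ε₀ < 1) (hθ : 0 < θ) {π : S → A → ℝ} (hπ : ∀ s, π s ∈ restrictedSimplex A ε₀)
    (lam : ℝ) {f : S → A → ℝ} (hf : ∀ s a, |f s a| ≤ 1) :
    |M.Vρ πτ f - M.Vρ π f| ≤ 1 / (1 - M.γ) ^ 2 *
      (2 * ε₀ + 2 * M.potential ε₀ πτ lamτ π lam / θ + Fintype.card A * θ / 2) := by
  have hm := M.one_sub_γ_pos
  have hm1 : 1 - M.γ ≤ 1 := by linarith [M.γ_mem.1]
  have hpol : IsPolicy π := fun s => (hπ s).1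
  have hD := M.stateVisit_nonneg hp
  have hD1 := M.sum_stateVisit hp
  have hl1 : ∀ s, ∑ a, |πτ s a - π s a| ≤ 2 * ε₀ +
      4 * klDivergence (uniformMix ε₀ (πτ s)) (π s) / (2 * θ) + Fintype.card A * (θ / 2) := by
    intro s
    have h1 : ∑ a, |πτ s a - π s a| ≤ ∑ a, |πτ s a - uniformMix ε₀ (πτ s) a| +
        ∑ a, |uniformMix ε₀ (πτ s) a - π s a| := by
      rw [← Finset.sum_add_distrib]
      exact Finset.sum_le_sum fun a _ => abs_sub_le _ _ _
    have h2 := abs_sub_uniformMix_le hε₀ (hp s)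
    have h3 : ∑ a, |uniformMix ε₀ (πτ s) a - π s a| ≤
        ∑ a, ((uniformMix ε₀ (πτ s) a - π s a) ^ 2 / (2 * θ) + θ / 2) :=
      Finset.sum_le_sum fun a _ => abs_le_sq_div_add hθ
    rw [Finset.sum_add_distrib, ← Finset.sum_div, Finset.sum_const, Finset.card_univ,
      nsmul_eq_mul] at h3
    have h4 := sum_sq_sub_le_klDivergence (uniformMix_mem hε₀ hε₁ (hp s)).1 (hpol s)
      (restrictedSimplex_pos hε₀ (hπ s))
    have h5 := div_le_div_of_nonneg_right h4 (by positivity : 0 ≤ 2 * θ)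
    linarith
  -- In this direction the states are weighted by the visitation of `πτ`, the same weights as in the
  -- potential.
  have hpd := M.performance_difference hpol hp f
  have h1 : (1 - M.γ) * |M.Vρ πτ f - M.Vρ π f| ≤ 1 / (1 - M.γ) *
      (2 * ε₀ + 4 * (∑ s, M.stateVisit πτ s * klDivergence (uniformMix ε₀ (πτ s)) (π s)) / (2 * θ) +
        Fintype.card A * (θ / 2)) := by
    rw [← abs_of_pos hm, ← abs_mul, abs_of_pos hm, hpd]
    refine (Finset.abs_sum_le_sum_abs _ _).trans ?_
    have h2 : ∀ s, |M.stateVisit πτ s * ∑ a, (πτ s a - π s a) * M.Q π f s a| ≤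
        1 / (1 - M.γ) * (M.stateVisit πτ s * (2 * ε₀ +
          4 * klDivergence (uniformMix ε₀ (πτ s)) (π s) / (2 * θ) +
            Fintype.card A * (θ / 2))) := by
      intro s
      rw [abs_mul, abs_of_nonneg (hD s), mul_left_comm]
      refine mul_le_mul_of_nonneg_left ?_ (hD s)
      refine (Finset.abs_sum_le_sum_abs _ _).trans ?_
      refine le_trans ?_ (mul_le_mul_of_nonneg_left (hl1 s) (by positivity : 0 ≤ 1 / (1 - M.γ)))
      rw [Finset.mul_sum]
      refine Finset.sum_le_sum fun a _ => ?_
      rw [abs_mul, mul_comm]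
      exact mul_le_mul_of_nonneg_right (M.abs_Q_le hpol hf s a) (abs_nonneg _)
    refine (Finset.sum_le_sum fun s _ => h2 s).trans (le_of_eq ?_)
    rw [← Finset.mul_sum]
    congr 1
    simp only [mul_add, Finset.sum_add_distrib, ← Finset.sum_mul, hD1, one_mul, Finset.mul_sum,
      Finset.sum_div]
    congr 2
    exact Finset.sum_congr rfl fun s _ => by ring
  set X := ∑ s, M.stateVisit πτ s * klDivergence (uniformMix ε₀ (πτ s)) (π s) with hX
  have hX0 : 0 ≤ X := Finset.sum_nonneg fun s _ => mul_nonneg (hD s)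
    (klDivergence_nonneg (uniformMix_mem hε₀ hε₁ (hp s)).1 (hpol s)
      (restrictedSimplex_pos hε₀ (hπ s)))
  have hXP : X ≤ M.potential ε₀ πτ lamτ π lam := by
    rw [potential, ← hX]
    have h2 : 1 ≤ 1 / (1 - M.γ) := by rw [le_div_iff₀ hm]; linarith
    nlinarith [sq_nonneg (lam - lamτ)]
  have h3 : 4 * X / (2 * θ) ≤ 2 * M.potential ε₀ πτ lamτ π lam / θ := by
    rw [show 4 * X / (2 * θ) = 2 * X / θ by field_simp; ring]
    gcongr
  have h4 : |M.Vρ πτ f - M.Vρ π f| ≤ 1 / (1 - M.γ) * (1 / (1 - M.γ) *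
      (2 * ε₀ + 4 * X / (2 * θ) + Fintype.card A * (θ / 2))) := by
    rw [one_div_mul_eq_div, le_div_iff₀ hm, mul_comm]
    exact h1
  refine h4.trans ?_
  rw [← mul_assoc, one_div_mul_one_div, ← sq]
  refine mul_le_mul_of_nonneg_left ?_ (by positivity)
  linarith

lemma potential_le [Nonempty A] (hp : IsPolicy πτ) {ε₀ m L : ℝ} (hε₀ : 0 < ε₀)
    (hε₁ : ε₀ < 1) (hm : 0 < m) {π : S → A → ℝ} (hπ : ∀ s a, m ≤ π s a) {lam : ℝ}
    (hlam : lam ∈ Set.Icc 0 L) (hlamτ : lamτ ∈ Set.Icc 0 L) :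
    M.potential ε₀ πτ lamτ π lam ≤ 1 / (1 - M.γ) * -Real.log m + L ^ 2 / 2 := by
  have hγ := M.one_sub_γ_pos
  refine add_le_add (mul_le_mul_of_nonneg_left ?_ (by positivity)) ?_
  · rw [← one_mul (-Real.log m), ← M.sum_stateVisit hp, Finset.sum_mul]
    exact Finset.sum_le_sum fun s _ => mul_le_mul_of_nonneg_left
      (klDivergence_le_neg_log (uniformMix_mem hε₀ hε₁ (hp s)).1 hm (hπ s))
      (M.stateVisit_nonneg hp s)
  · have : (lam - lamτ) ^ 2 ≤ L ^ 2 := by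
      apply sq_le_sq'
      · linarith [hlam.1, hlamτ.2]
      · linarith [hlam.2, hlamτ.1]
    linarith

lemma potential_nonneg [Nonempty A] (hp : IsPolicy πτ) {ε₀ : ℝ} (hε₀ : 0 < ε₀)
    (hε₁ : ε₀ < 1) {π : S → A → ℝ} (hπ : ∀ s, π s ∈ restrictedSimplex A ε₀) (lam : ℝ) :
    0 ≤ M.potential ε₀ πτ lamτ π lam := by
  have hγ := M.one_sub_γ_pos
  refine add_nonneg (mul_nonneg (by positivity) (Finset.sum_nonneg fun s _ => ?_)) (by positivity)
  exact mul_nonneg (M.stateVisit_nonneg hp s) (klDivergence_nonneg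
    (uniformMix_mem hε₀ hε₁ (hp s)).1 (hπ s).1 (restrictedSimplex_pos hε₀ (hπ s)))

lemma measurable_potential {Ω : Type*} [MeasurableSpace Ω] {π : Ω → S → A → ℝ} {lam : Ω → ℝ}
    (hπ : Measurable π) (hlam : Measurable lam) (ε₀ : ℝ) :
    Measurable fun ω => M.potential ε₀ πτ lamτ (π ω) (lam ω) := by
  have hc : ∀ s a, Measurable fun ω => π ω s a :=
    fun s a => (measurable_pi_apply a).comp ((measurable_pi_apply s).comp hπ)
  refine Measurable.add (Measurable.const_mul (Finset.measurable_sum _ fun s _ =>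
    Measurable.const_mul ?_ _) _) (((hlam.sub_const _).pow_const 2).div_const 2)
  exact Finset.measurable_sum _ fun a _ =>
    Measurable.const_mul (Real.measurable_log.comp ((hc s a).const_div _)) _

end Potential

end CMDP

/-- The affine recursion has fixed point `b`, and the distance above it decays geometrically. -/
lemma le_exp_mul_add_of_recursion {a : ℕ → ℝ} {x b P : ℝ} (hx1 : x ≤ 1) (hb : 0 ≤ b)
    (hP : 0 ≤ P) (h0 : a 0 ≤ P) (h : ∀ t, a (t + 1) ≤ (1 - x) * a t + x * b) (t : ℕ) :
    a t ≤ Real.exp (-(x * t)) * P + b := by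
  have h1 : a t ≤ (1 - x) ^ t * P + b := by
    induction t with
    | zero => simpa using h0.trans (by linarith)
    | succ t ih =>
      have := mul_le_mul_of_nonneg_left ih (sub_nonneg.2 hx1)
      rw [pow_succ']
      linarith [h t]
  have h2 : (1 - x) ^ t ≤ Real.exp (-(x * t)) := by
    have h3 : 1 - x ≤ Real.exp (-x) := by linarith [Real.add_one_le_exp (-x)]
    calc (1 - x) ^ t ≤ Real.exp (-x) ^ t := pow_le_pow_left₀ (sub_nonneg.2 hx1) h3 t
      _ = Real.exp (-(x * t)) := by rw [← Real.exp_nat_mul]; ring_nf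
  have := mul_le_mul_of_nonneg_right h2 hP
  linarith

namespace CMDP

/-! ### The recursion in expectation. -/

section Expectation

variable {S A : Type*} [Fintype S] [Fintype A] {M : CMDP S A} {ξ τ : ℝ} {πτ : S → A → ℝ}
  {lamτ : ℝ} {d : ℕ} {φ : S → A → EuclideanSpace ℝ (Fin d)}
  {Ω : Type*} [MeasurableSpace Ω] {ℙ : Measure Ω} {ε₀ η W : ℝ}
  {π : ℕ → Ω → S → A → ℝ} {lam : ℕ → Ω → ℝ} {w wstar : ℕ → Ω → EuclideanSpace ℝ (Fin d)}

lemma IsInexactRPGPD.mem_restrictedSimplex (h : M.IsInexactRPGPD φ ξ ε₀ η τ W π lam w) (t : ℕ)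
    (ω : Ω) (s : S) : π t ω s ∈ restrictedSimplex A ε₀ := by
  cases t with
  | zero => exact h.π_zero_mem ω s
  | succ t => exact h.π_succ_mem t ω s

lemma IsInexactRPGPD.mem_dualSet (h : M.IsInexactRPGPD φ ξ ε₀ η τ W π lam w) (t : ℕ)
    (ω : Ω) : lam t ω ∈ M.dualSet ξ := by
  cases t with
  | zero => exact h.lam_zero_mem ω
  | succ t => exact h.lam_succ_mem t ω

lemma IsInexactRPGPD.isPolicy (h : M.IsInexactRPGPD φ ξ ε₀ η τ W π lam w) (t : ℕ)
    (ω : Ω) : IsPolicy (π t ω) := fun s => (h.mem_restrictedSimplex t ω s).1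

lemma integrable_Vρ [IsProbabilityMeasure ℙ] (h : M.IsInexactRPGPD φ ξ ε₀ η τ W π lam w) (t : ℕ)
    {f : S → A → ℝ} (hf : ∀ s a, |f s a| ≤ 1) : Integrable (fun ω => M.Vρ (π t ω) f) ℙ :=
  Integrable.of_bound (M.measurable_Vρ (h.measurable_π t) (h.isPolicy t) f).aestronglyMeasurable
    (1 / (1 - M.γ)) (Filter.Eventually.of_forall fun ω => M.abs_Vρ_le (h.isPolicy t ω) hf)

/-- The bound through `log (ε₀ / |A|)` serves integrability only. It does not enter the rates, so
`ε₀` may be arbitrarily small. -/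
lemma integrable_potential [Nonempty A] [IsProbabilityMeasure ℙ] (hs : M.IsRegSaddle ξ τ πτ lamτ)
    (hε₀ : 0 < ε₀) (hε₁ : ε₀ < 1) (h : M.IsInexactRPGPD φ ξ ε₀ η τ W π lam w) (t : ℕ) :
    Integrable (fun ω => M.potential ε₀ πτ lamτ (π t ω) (lam t ω)) ℙ := by
  have hc : (0 : ℝ) < Fintype.card A := by exact_mod_cast Fintype.card_pos
  refine Integrable.of_bound
    (measurable_potential (h.measurable_π t) (h.measurable_lam t) ε₀).aestronglyMeasurable
    (1 / (1 - M.γ) * -Real.log (ε₀ / Fintype.card A) + (1 / ((1 - M.γ) * ξ)) ^ 2 / 2)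
    (Filter.Eventually.of_forall fun ω => ?_)
  rw [Real.norm_eq_abs, abs_of_nonneg
    (potential_nonneg hs.1 hε₀ hε₁ (h.mem_restrictedSimplex t ω) _)]
  exact potential_le hs.1 hε₀ hε₁ (by positivity) (fun s => (h.mem_restrictedSimplex t ω s).2)
    (h.mem_dualSet t ω) hs.2.1

/-- Split at `wstar`: the remainder there is the bias. The form at `w - wstar` passes to `ν` at cost
`K`, then to the on-policy law at cost `1 / (1 - γ)`, where it is the excess error. -/
lemma approxError_transferLaw_le {ν : S → A → ℝ} {εstat εbias K : ℝ} (hs : IsPolicy πτ)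
    (hν : ∀ s a, 0 ≤ ν s a) (hK0 : 0 ≤ K)
    (hK : ∀ v, covForm φ (M.transferLaw πτ) v ≤ K * covForm φ ν v)
    (h : M.IsInexactRPGPD φ ξ ε₀ η τ W π lam w)
    (hE : M.BoundedErrors φ ℙ τ ν πτ π lam w wstar εstat εbias) (t : ℕ) (ω : Ω) :
    M.approxError φ τ (π t ω) (lam t ω) (M.transferLaw πτ) (w t ω) ≤
      2 * K / (1 - M.γ) *
        (M.approxError φ τ (π t ω) (lam t ω) (M.saVisit (π t ω) ν) (w t ω) -
          M.approxError φ τ (π t ω) (lam t ω) (M.saVisit (π t ω) ν) (wstar t ω)) +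
      2 * M.approxError φ τ (π t ω) (lam t ω) (M.transferLaw πτ) (wstar t ω) := by
  have hm := M.one_sub_γ_pos
  have htr : ∀ s a, 0 ≤ M.transferLaw πτ s a := fun s a =>
    mul_nonneg (M.stateVisit_nonneg hs s) (by positivity)
  have h1 := M.approxError_le_two_mul φ τ (π t ω) (lam t ω) htr (w t ω) (wstar t ω)
  rw [M.approxError_sub_of_min φ τ (π t ω) (lam t ω) (hE.wstar_min t ω)]
  have h2 := hK (w t ω - wstar t ω)
  have h3 := M.one_sub_γ_mul_covForm_le φ (h.isPolicy t ω) hν (w t ω - wstar t ω)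
  have h4 : covForm φ ν (w t ω - wstar t ω) ≤
      covForm φ (M.saVisit (π t ω) ν) (w t ω - wstar t ω) / (1 - M.γ) := by
    rw [le_div_iff₀ hm, mul_comm]; exact h3
  have h5 := mul_le_mul_of_nonneg_left h4 hK0
  have h6 : 2 * K / (1 - M.γ) * covForm φ (M.saVisit (π t ω) ν) (w t ω - wstar t ω) =
      2 * (K * (covForm φ (M.saVisit (π t ω) ν) (w t ω - wstar t ω) / (1 - M.γ))) := by ring
  rw [h6]
  linarith

lemma integral_potential_le [Nonempty A] [IsProbabilityMeasure ℙ]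
    {ν : S → A → ℝ} {εstat εbias K e θ P : ℝ}
    (hs : M.IsRegSaddle ξ τ πτ lamτ) (hν : ∀ s a, 0 ≤ ν s a) (hK0 : 0 ≤ K)
    (hK : ∀ v, covForm φ (M.transferLaw πτ) v ≤ K * covForm φ ν v)
    (hε₀ : 0 < ε₀) (hε₁ : ε₀ < 1) (hη : 0 < η) (hη1 : η ≤ 1) (hτ : 0 < τ) (hτ1 : τ ≤ 1)
    (hθ : 0 < θ) (hφ : ∀ s a, ‖φ s a‖ ≤ 1) (hW : 0 < W) (hηW : η * W ≤ 1) (hξ : 0 < ξ)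
    (he : 0 ≤ e) (hstat : εstat ≤ e) (hbias : εbias ≤ e)
    (h : M.IsInexactRPGPD φ ξ ε₀ η τ W π lam w)
    (hE : M.BoundedErrors φ ℙ τ ν πτ π lam w wstar εstat εbias)
    (hP0 : 0 ≤ P) (hP : ∀ ω, M.potential ε₀ πτ lamτ (π 0 ω) (lam 0 ω) ≤ P) (t : ℕ) :
    ∫ ω, M.potential ε₀ πτ lamτ (π t ω) (lam t ω) ∂ℙ ≤ Real.exp (-(η * τ * t)) * P +
      (1 / (1 - M.γ) * (2 * √(Fintype.card A) * √ε₀) +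
        (1 / (1 - M.γ) * (2 * ε₀ * W) + 1 / (1 - M.γ) * η * W ^ 2 +
        η * (1 / (1 - M.γ) + 1 / ((1 - M.γ) * ξ)) ^ 2 / 2 +
        1 / (1 - M.γ) * Fintype.card A *
          ((2 * K / (1 - M.γ) + 2) * e / (2 * θ) + θ / 2)) / τ) := by
  have hm := M.one_sub_γ_pos
  have hint := fun t => integrable_potential (ℙ := ℙ) hs hε₀ hε₁ h t
  refine le_exp_mul_add_of_recursion (a := fun t =>
    ∫ ω, M.potential ε₀ πτ lamτ (π t ω) (lam t ω) ∂ℙ) (x := η * τ)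
    (mul_le_one₀ hη1 hτ.le hτ1) (by positivity) hP0 ?_ (fun t => ?_) t
  · calc ∫ ω, M.potential ε₀ πτ lamτ (π 0 ω) (lam 0 ω) ∂ℙ ≤ ∫ _, P ∂ℙ :=
        integral_mono (hint 0) (integrable_const P) hP
      _ = P := by simp
  set Y := 1 / (1 - M.γ) + 1 / ((1 - M.γ) * ξ) with hYdef
  have hY : ∀ ω, |M.Vρ (π t ω) M.g + τ * lam t ω| ≤ Y := by
    intro ω
    have hl := h.mem_dualSet t ω
    refine (abs_add_le _ _).trans (add_le_add (M.abs_Vρ_le (h.isPolicy t ω) M.abs_g_le) ?_)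
    rw [abs_of_nonneg (mul_nonneg hτ.le hl.1)]
    exact (mul_le_of_le_one_left hl.1 hτ1).trans hl.2
  set G : Ω → ℝ := fun ω => M.approxError φ τ (π t ω) (lam t ω) (M.saVisit (π t ω) ν) (w t ω) -
    M.approxError φ τ (π t ω) (lam t ω) (M.saVisit (π t ω) ν) (wstar t ω) with hG
  set H : Ω → ℝ := fun ω =>
    M.approxError φ τ (π t ω) (lam t ω) (M.transferLaw πτ) (wstar t ω) with hH
  have hGi : Integrable G ℙ := hE.stat_integrable t
  have hHi : Integrable H ℙ := hE.bias_integrable t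
  have hG1 : ∫ ω, G ω ∂ℙ ≤ e := (hE.stat_le t).trans hstat
  have hH1 : ∫ ω, H ω ∂ℙ ≤ e := (hE.bias_le t).trans hbias
  set R := η * τ * (1 / (1 - M.γ)) * (2 * √(Fintype.card A) * √ε₀) +
        η / (1 - M.γ) * (2 * ε₀ * W) + (η * W) ^ 2 / (1 - M.γ) + η ^ 2 * Y ^ 2 / 2 +
        η / (1 - M.γ) * Fintype.card A * (θ / 2) with hR
  set u := η / (1 - M.γ) * Fintype.card A / (2 * θ) with hu
  have hu0 : 0 ≤ u := by positivity
  have hstep : ∀ ω, M.potential ε₀ πτ lamτ (π (t + 1) ω) (lam (t + 1) ω) ≤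
      (1 - η * τ) * M.potential ε₀ πτ lamτ (π t ω) (lam t ω) +
        (u * (2 * K / (1 - M.γ)) * G ω + u * 2 * H ω + R) := by
    intro ω
    have h1 := potential_step hs hε₀ hε₁ hη hτ hθ hφ (h.norm_w_le t ω) hηW
      (h.mem_restrictedSimplex t ω) (h.π_succ_mem t ω) (h.π_succ_max t ω) (h.mem_dualSet t ω)
      (h.lam_succ_mem t ω) (h.lam_succ_min t ω) (hY ω)
    have h2 := mul_le_mul_of_nonneg_left
      (approxError_transferLaw_le hs.1 hν hK0 hK h hE t ω) hu0
    have h3 : ∀ x : ℝ, η / (1 - M.γ) * Fintype.card A * (x / (2 * θ) + θ / 2) =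
        u * x + η / (1 - M.γ) * Fintype.card A * (θ / 2) := fun x => by rw [hu]; ring
    rw [h3] at h1
    simp only [hG, hH]
    linarith
  have hi0 : Integrable (fun ω => u * (2 * K / (1 - M.γ)) * G ω + u * 2 * H ω) ℙ :=
    (hGi.const_mul _).add (hHi.const_mul _)
  have hi1 : Integrable (fun ω => u * (2 * K / (1 - M.γ)) * G ω + u * 2 * H ω + R) ℙ :=
    hi0.add (integrable_const R)
  have hmono := integral_mono (hint (t + 1)) (((hint t).const_mul (1 - η * τ)).add hi1) hstep
  have heval : ∫ ω, ((1 - η * τ) * M.potential ε₀ πτ lamτ (π t ω) (lam t ω) +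
        (u * (2 * K / (1 - M.γ)) * G ω + u * 2 * H ω + R)) ∂ℙ =
      (1 - η * τ) * ∫ ω, M.potential ε₀ πτ lamτ (π t ω) (lam t ω) ∂ℙ +
        (u * (2 * K / (1 - M.γ)) * ∫ ω, G ω ∂ℙ + u * 2 * ∫ ω, H ω ∂ℙ + R) := by
    rw [integral_add ((hint t).const_mul _) hi1,
      integral_add hi0 (integrable_const R),
      integral_add (hGi.const_mul _) (hHi.const_mul _), integral_const_mul, integral_const_mul,
      integral_const_mul]
    simp
  have hmono' := hmono.trans_eq heval
  have h4 := mul_le_mul_of_nonneg_left hG1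
    (by positivity : 0 ≤ u * (2 * K / (1 - M.γ)))
  have h5 := mul_le_mul_of_nonneg_left hH1 (by positivity : 0 ≤ u * 2)
  refine hmono'.trans ?_
  -- The expected error per step, rewritten as `ητ` times the fixed point of the recursion.
  have h6 : η * τ * (1 / (1 - M.γ) * (2 * √(Fintype.card A) * √ε₀) +
        (1 / (1 - M.γ) * (2 * ε₀ * W) + 1 / (1 - M.γ) * η * W ^ 2 + η * Y ^ 2 / 2 +
        1 / (1 - M.γ) * Fintype.card A *
          ((2 * K / (1 - M.γ) + 2) * e / (2 * θ) + θ / 2)) / τ) =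
      u * (2 * K / (1 - M.γ)) * e + u * 2 * e + R := by
    rw [hR, hu]
    field_simp
    ring
  rw [h6]
  linarith

/-- The expected difference of the values of the saddle-point policy and of an iterate. -/
lemma Vρ_sub_integral_Vρ_le [Nonempty A] [IsProbabilityMeasure ℙ] {θ : ℝ}
    (hs : M.IsRegSaddle ξ τ πτ lamτ) (hε₀ : 0 < ε₀) (hε₁ : ε₀ < 1) (hθ : 0 < θ)
    (h : M.IsInexactRPGPD φ ξ ε₀ η τ W π lam w) (t : ℕ) {f : S → A → ℝ}
    (hf : ∀ s a, |f s a| ≤ 1) :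
    M.Vρ πτ f - ∫ ω, M.Vρ (π t ω) f ∂ℙ ≤ 1 / (1 - M.γ) ^ 2 *
      (2 * ε₀ + 2 * (∫ ω, M.potential ε₀ πτ lamτ (π t ω) (lam t ω) ∂ℙ) / θ +
        Fintype.card A * θ / 2) := by
  have hint := integrable_potential (ℙ := ℙ) hs hε₀ hε₁ h t
  have hV := integrable_Vρ (ℙ := ℙ) h t hf
  have hi0 : Integrable (fun ω => 2 * ε₀ + 2 * M.potential ε₀ πτ lamτ (π t ω) (lam t ω) / θ) ℙ :=
    (integrable_const _).add ((hint.const_mul 2).div_const θ)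
  have hi : Integrable (fun ω => 2 * ε₀ + 2 * M.potential ε₀ πτ lamτ (π t ω) (lam t ω) / θ +
      Fintype.card A * θ / 2) ℙ :=
    hi0.add (integrable_const _)
  have h1 := integral_mono ((integrable_const (M.Vρ πτ f)).sub hV)
    (hi.const_mul (1 / (1 - M.γ) ^ 2)) fun ω => (le_abs_self _).trans
      (abs_Vρ_sub_le_potential hs.1 hε₀ hε₁ hθ (h.mem_restrictedSimplex t ω) (lam t ω) hf)
  have h2 : ∫ ω, (2 * ε₀ + 2 * M.potential ε₀ πτ lamτ (π t ω) (lam t ω) / θ +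
      Fintype.card A * θ / 2) ∂ℙ = 2 * ε₀ +
      2 * (∫ ω, M.potential ε₀ πτ lamτ (π t ω) (lam t ω) ∂ℙ) / θ + Fintype.card A * θ / 2 := by
    rw [integral_add hi0 (integrable_const _), integral_add (integrable_const _) ((hint.const_mul 2).div_const θ),
      integral_div, integral_const_mul 2 fun ω => M.potential ε₀ πτ lamτ (π t ω) (lam t ω)]
    simp
  rw [integral_const_mul, h2] at h1
  refine le_trans (le_of_eq ?_) h1
  simp only [Pi.sub_apply]
  rw [integral_sub (integrable_const _) hV]
  simp

end Expectation

end CMDP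

/-! ### Orders of magnitude and the main theorem. -/

/-- After `C ε⁻⁶ log² (1/ε)` steps a contraction at rate of order `ε⁶` has forgotten an initial value
that is logarithmic in `1/ε`. -/
lemma exp_mul_log_le {α c ε x i B : ℝ} {k t : ℕ} (hα : 0 < α) (hc : 0 < c) (hε : 0 < ε)
    (hε3 : ε < 1 / 3) (hi : 0 ≤ i) (hB : 0 ≤ B)
    (hsmall : ε * (i * (|Real.log α| + k * |Real.log c| + k) + B) ≤ c ^ 2)
    (hx : α ^ 2 * (c * ε) ^ 6 ≤ x)
    (ht : 4 / (α ^ 2 * c ^ 6) * (1 / ε ^ 6) * Real.log (1 / ε) ^ 2 ≤ t) :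
    Real.exp (-(x * t)) * |i * -Real.log (α * (c * ε) ^ k) + B| ≤ (c * ε) ^ 2 := by
  -- Here `ε < 1 / 3` is used, as `e < 3`. It lets `log² (1 / ε)` be bounded below by `log (1 / ε)`,
  -- which is all the decay needs.
  have hl1 : 1 ≤ Real.log (1 / ε) := by
    rw [Real.le_log_iff_exp_le (by positivity)]
    have := Real.exp_one_lt_d9
    have h3 : (3 : ℝ) ≤ 1 / ε := by
      rw [le_div_iff₀ hε]; linarith
    linarith
  have hlε : Real.log (1 / ε) ≤ 1 / ε := Real.log_le_self (by positivity)
  have hlog : Real.log (α * (c * ε) ^ k) = Real.log α + k * Real.log c - k * Real.log (1 / ε) := by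
    rw [Real.log_mul hα.ne' (by positivity), Real.log_pow, Real.log_mul hc.ne' hε.ne',
      one_div, Real.log_inv]
    ring
  have hk : (0 : ℝ) ≤ k := Nat.cast_nonneg k
  have h1ε : 1 ≤ 1 / ε := hl1.trans hlε
  have habs : |i * -Real.log (α * (c * ε) ^ k) + B| ≤
      (i * (|Real.log α| + k * |Real.log c| + k) + B) / ε := by
    have h1 : |-Real.log (α * (c * ε) ^ k)| ≤ (|Real.log α| + k * |Real.log c| + k) * (1 / ε) := by
      rw [abs_neg, hlog]
      have h2 : |Real.log α + k * Real.log c - k * Real.log (1 / ε)| ≤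
          |Real.log α| + k * |Real.log c| + k * Real.log (1 / ε) := by
        refine (abs_sub _ _).trans (add_le_add ((abs_add_le _ _).trans ?_) ?_)
        · rw [abs_mul, abs_of_nonneg hk]
        · rw [abs_of_nonneg (mul_nonneg hk (by linarith))]
      have h3 := mul_le_mul_of_nonneg_left hlε hk
      have h4 : 0 ≤ |Real.log α| + k * |Real.log c| := by positivity
      have h5 := le_mul_of_one_le_right h4 h1ε
      linarith
    refine (abs_add_le _ _).trans ?_
    rw [abs_mul, abs_of_nonneg hi, abs_of_nonneg hB, add_div]
    refine add_le_add ((mul_le_mul_of_nonneg_left h1 hi).trans (le_of_eq (by ring))) ?_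
    rw [div_eq_mul_one_div]
    exact le_mul_of_one_le_right hB h1ε
  -- The factor 4 in the number of steps yields `ε ^ 4`: one power absorbs the crude `1 / ε` bound
  -- in `habs`, one is spent in `hsmall`, and two remain.
  have hexp : Real.exp (-(x * t)) ≤ ε ^ 4 := by
    have h1 : 4 * Real.log (1 / ε) ≤ x * t := by
      have h2 := mul_le_mul hx ht (by positivity) ((by positivity : 0 ≤ α ^ 2 * (c * ε) ^ 6).trans hx)
      have h3 : α ^ 2 * (c * ε) ^ 6 *
          (4 / (α ^ 2 * c ^ 6) * (1 / ε ^ 6) * Real.log (1 / ε) ^ 2) =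
          4 * Real.log (1 / ε) ^ 2 := by field_simp
      rw [h3] at h2
      nlinarith
    calc Real.exp (-(x * t)) ≤ Real.exp (-(4 * Real.log (1 / ε))) := by
          rw [Real.exp_le_exp]; linarith
      _ = ε ^ 4 := by
          rw [one_div, Real.log_inv, ← Real.exp_log (pow_pos hε 4), Real.log_pow]
          congr 1
          push_cast
          ring
  calc Real.exp (-(x * t)) * |i * -Real.log (α * (c * ε) ^ k) + B|
      ≤ ε ^ 4 * ((i * (|Real.log α| + k * |Real.log c| + k) + B) / ε) :=
        mul_le_mul hexp habs (abs_nonneg _) (by positivity)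
    _ = ε ^ 2 * (ε * (i * (|Real.log α| + k * |Real.log c| + k) + B)) := by field_simp
    _ ≤ ε ^ 2 * c ^ 2 := mul_le_mul_of_nonneg_left hsmall (by positivity)
    _ = (c * ε) ^ 2 := by ring

/-- The stationary part of the potential bound is of order `δ²`. -/
lemma stationary_bound {α β δ i n W Y K ε₀ η τ : ℝ} (hα : 0 < α) (hβ : 0 < β)
    (hδ : 0 < δ) (hi : 0 ≤ i) (hn : 0 ≤ n) (hW : 0 ≤ W) (hK : 0 ≤ K)
    (hε₀ : ε₀ ≤ β * δ ^ 4) (hη : η ≤ β * δ ^ 4) (hτ : α * δ ^ 2 ≤ τ) :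
    i * (2 * √n * √ε₀) + (i * (2 * ε₀ * W) + i * η * W ^ 2 + η * Y ^ 2 / 2 +
      i * n * (K * (β * δ ^ 8) / (2 * δ ^ 4) + δ ^ 4 / 2)) / τ ≤
    (i * (2 * √n * √β) + (i * (2 * β * W) + i * β * W ^ 2 + β * Y ^ 2 / 2 +
      i * n * (K * β / 2 + 1 / 2)) / α) * δ ^ 2 := by
  have hτ0 : 0 < τ := lt_of_lt_of_le (by positivity) hτ
  have hsq : √ε₀ ≤ √β * δ ^ 2 := by
    calc √ε₀ ≤ √(β * δ ^ 4) := Real.sqrt_le_sqrt hε₀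
      _ = √β * δ ^ 2 := by
        rw [Real.sqrt_mul hβ.le, show δ ^ 4 = (δ ^ 2) ^ 2 by ring, Real.sqrt_sq (by positivity)]
  have h1 : i * (2 * √n * √ε₀) ≤ i * (2 * √n * √β) * δ ^ 2 := by
    have := mul_le_mul_of_nonneg_left hsq (by positivity : 0 ≤ i * (2 * √n))
    linarith
  have h2 : i * (2 * ε₀ * W) + i * η * W ^ 2 + η * Y ^ 2 / 2 +
      i * n * (K * (β * δ ^ 8) / (2 * δ ^ 4) + δ ^ 4 / 2) ≤
      (i * (2 * β * W) + i * β * W ^ 2 + β * Y ^ 2 / 2 + i * n * (K * β / 2 + 1 / 2)) * δ ^ 4 := by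
    have h3 := mul_le_mul_of_nonneg_left hε₀ (by positivity : 0 ≤ i * 2 * W)
    have h4 := mul_le_mul_of_nonneg_left hη (by positivity : 0 ≤ i * W ^ 2)
    have h5 := mul_le_mul_of_nonneg_left hη (by positivity : 0 ≤ Y ^ 2 / 2)
    have h6 : K * (β * δ ^ 8) / (2 * δ ^ 4) + δ ^ 4 / 2 = (K * β / 2 + 1 / 2) * δ ^ 4 := by
      -- With Young parameter `δ ^ 4`, squared errors of order `δ ^ 8` and the Young remainder are
      -- both of order `δ ^ 4`.
      field_simp
    rw [h6]
    linarith
  set Z := i * (2 * β * W) + i * β * W ^ 2 + β * Y ^ 2 / 2 + i * n * (K * β / 2 + 1 / 2) with hZ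
  have hZ0 : 0 ≤ Z := by positivity
  have h3 : Z * δ ^ 4 / τ ≤ Z / α * δ ^ 2 := by
    rw [div_le_iff₀ hτ0]
    have h4 := mul_le_mul_of_nonneg_left hτ (by positivity : 0 ≤ Z / α * δ ^ 2)
    have h5 : Z / α * δ ^ 2 * (α * δ ^ 2) = Z * δ ^ 4 := by field_simp
    linarith
  have h4 := div_le_div_of_nonneg_right h2 hτ0.le
  rw [add_mul]
  linarith

set_option maxHeartbeats 800000 in
theorem corollary2 {S A : Type*} [Fintype S] [Fintype A] (M : CMDP S A)
    (ξ : ℝ) (hξ : 0 < ξ) (hfeas : M.Feasible ξ)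
    {d : ℕ} (φ : S → A → EuclideanSpace ℝ (Fin d)) (hφ : ∀ s a, ‖φ s a‖ ≤ 1)
    (W : ℝ) (hW : 0 < W)
    (ν : S → A → ℝ) (hν : ∀ s a, 0 ≤ ν s a) (hν_sum : ∑ s, ∑ a, ν s a = 1)
    -- the implied constants in the orders of magnitude below
    (α β : ℝ) (hα : 0 < α) (hβ : 0 < β) (k : ℕ) :
    ∃ c > 0, ∃ C > 0, ∃ εmax > 0, ∀ ε : ℝ, 0 < ε → ε < εmax →
      ∀ η τ ε₀ εstat εbias : ℝ,
        α * (c * ε) ^ 4 ≤ η → η ≤ β * (c * ε) ^ 4 →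
        α * (c * ε) ^ 2 ≤ τ → τ ≤ β * (c * ε) ^ 2 →
        0 < ε₀ → ε₀ < 1 → ε₀ ≤ β * (c * ε) ^ 4 →
        εstat ≤ β * (c * ε) ^ 8 → εbias ≤ β * (c * ε) ^ 8 →
      ∀ (Ω : Type*) [MeasurableSpace Ω] (ℙ : Measure Ω) [IsProbabilityMeasure ℙ]
        (π : ℕ → Ω → S → A → ℝ) (lam : ℕ → Ω → ℝ)
        (w wstar : ℕ → Ω → EuclideanSpace ℝ (Fin d)) (πτ : S → A → ℝ) (lamτ : ℝ),
        M.IsRegSaddle ξ τ πτ lamτ →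
        M.IsInexactRPGPD φ ξ ε₀ η τ W π lam w →
        (∀ ω s a, α * (c * ε) ^ k ≤ π 0 ω s a) →
        M.BoundedErrors φ ℙ τ ν πτ π lam w wstar εstat εbias →
      ∀ πstar : S → A → ℝ, M.IsOptimal πstar →
      ∀ t : ℕ, C * (1 / ε ^ 6) * Real.log (1 / ε) ^ 2 ≤ t →
        (Integrable (fun ω => M.Vρ πstar M.r - M.Vρ (π t ω) M.r) ℙ ∧
          ∫ ω, (M.Vρ πstar M.r - M.Vρ (π t ω) M.r) ∂ℙ ≤ ε) ∧
        (Integrable (fun ω => -M.Vρ (π t ω) M.g) ℙ ∧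
          ∫ ω, -M.Vρ (π t ω) M.g ∂ℙ ≤ ε) := by
  classical
  have hm := M.one_sub_γ_pos
  -- `πτ` depends on `τ`, hence on `ε`; `K` must be fixed before either.
  obtain ⟨K, hK0, hK⟩ := CMDP.exists_uniform_covForm_le φ hν
  have hS : Nonempty S := by
    by_contra hS
    rw [not_nonempty_iff] at hS
    have := M.ρ_mem.2
    simp at this
  have hA : Nonempty A := by
    obtain ⟨πb, hπb, -⟩ := hfeas
    by_contra hA
    rw [not_nonempty_iff] at hA
    have := (hπb hS.some).2
    simp at this
  set i : ℝ := 1 / (1 - M.γ) with hi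
  have hi0 : 0 < i := by positivity
  set n : ℝ := (Fintype.card A : ℝ) with hn
  have hn0 : 0 ≤ n := Nat.cast_nonneg _
  set L : ℝ := 1 / ((1 - M.γ) * ξ) with hL
  have hL0 : 0 < L := by positivity
  set C₁ : ℝ := i * (2 * √n * √β) + (i * (2 * β * W) + i * β * W ^ 2 + β * (i + L) ^ 2 / 2 +
      i * n * ((2 * K / (1 - M.γ) + 2) * β / 2 + 1 / 2)) / α with hC₁
  have hC₁0 : 0 ≤ C₁ := by positivity
  -- The distance of the iterate to the saddle policy, plus the bias of that policy in optimality
  -- and in feasibility, all in units of `δ`; `c = 1 / C₂` then gives `C₂ * δ = ε`.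
  set C₂ : ℝ := 1 / (1 - M.γ) ^ 2 * (2 * β + 2 * (1 + C₁) + n / 2) +
    β * (n / (1 - M.γ) + (L + ξ * n)) with hC₂
  have hC₂0 : 0 < C₂ := by positivity
  set c : ℝ := 1 / C₂ with hc
  have hc0 : 0 < c := by positivity
  set P : ℝ := i * (|Real.log α| + k * |Real.log c| + k) + L ^ 2 / 2 with hP
  have hP0 : 0 < P := by positivity
  -- The three caps on `ε` serve, in order, `log (1 / ε) ≥ 1`; the bounds by 1 on `δ`, `η`, `τ` and
  -- `η * W`; and the forgetting of the initial potential.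
  refine ⟨c, hc0, 4 / (α ^ 2 * c ^ 6), by positivity,
    min (1 / 3) (min (1 / (c * (1 + β + β * W))) (c ^ 2 / P)), by positivity, ?_⟩
  intro ε hε hεmax η τ ε₀ εstat εbias hη hη' hτ hτ' hε₀ hε₁ hε₀' hstat hbias Ω _ ℙ _ π lam w
    wstar πτ lamτ hs halg hπ0 hE πstar hstar t ht
  rw [lt_min_iff, lt_min_iff, lt_div_iff₀ hP0] at hεmax
  obtain ⟨hε3, hεc, hεP⟩ := hεmax
  rw [lt_div_iff₀ (by positivity)] at hεc
  set δ := c * ε with hδ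
  have hδ0 : 0 < δ := by positivity
  have hδs : δ * (1 + β + β * W) ≤ 1 := by
    have : δ * (1 + β + β * W) = ε * (c * (1 + β + β * W)) := by rw [hδ]; ring
    linarith
  have hβδ : 0 < β * δ := by positivity
  have hβWδ : 0 < β * W * δ := by positivity
  have hδ1 : δ ≤ 1 := by linarith
  have hδ4 : δ ^ 4 ≤ δ := pow_le_of_le_one hδ0.le hδ1 (by norm_num)
  have hδ2 : δ ^ 2 ≤ δ := pow_le_of_le_one hδ0.le hδ1 (by norm_num)
  have hη0 : 0 < η := lt_of_lt_of_le (by positivity) hη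
  have hτ0 : 0 < τ := lt_of_lt_of_le (by positivity) hτ
  have hηδ : η ≤ β * δ := hη'.trans (mul_le_mul_of_nonneg_left hδ4 hβ.le)
  have hτδ : τ ≤ β * δ := hτ'.trans (mul_le_mul_of_nonneg_left hδ2 hβ.le)
  have hεδ : ε₀ ≤ β * δ := hε₀'.trans (mul_le_mul_of_nonneg_left hδ4 hβ.le)
  have hηW : η * W ≤ 1 := by
    have := mul_le_mul_of_nonneg_right hηδ hW.le
    linarith
  have hKτ : ∀ v, CMDP.covForm φ (M.transferLaw πτ) v ≤ K * CMDP.covForm φ ν v :=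
    hK (M.stateVisit πτ) (M.stateVisit_nonneg hs.1) (M.sum_stateVisit hs.1)
      hE.relCondNumber_lt_top
  -- the potential at time `t`
  have hpot : ∫ ω, M.potential ε₀ πτ lamτ (π t ω) (lam t ω) ∂ℙ ≤ (1 + C₁) * δ ^ 2 := by
    have h1 := CMDP.integral_potential_le (e := β * δ ^ 8) (θ := δ ^ 4)
      (P := |i * -Real.log (α * δ ^ k) + L ^ 2 / 2|) hs hν hK0 hKτ hε₀ hε₁ hη0
      (by linarith) hτ0 (by linarith) (by positivity) hφ hW hηW hξ (by positivity) hstat hbias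
      halg hE (abs_nonneg _)
      (fun ω => (CMDP.potential_le hs.1 hε₀ hε₁ (by positivity) (hπ0 ω) (halg.lam_zero_mem ω)
        hs.2.1).trans (le_abs_self _)) t
    have h2 := exp_mul_log_le (x := η * τ) (B := L ^ 2 / 2) (k := k) (t := t) hα hc0 hε hε3 hi0.le
      (by positivity) hεP.le
      (by
        have := mul_le_mul hη hτ (by positivity) hη0.le
        calc α ^ 2 * (c * ε) ^ 6 = α * δ ^ 4 * (α * δ ^ 2) := by rw [hδ]; ring
          _ ≤ _ := this) ht
    have h3 := stationary_bound (W := W) (Y := i + L) (K := 2 * K / (1 - M.γ) + 2) hα hβ hδ0 hi0.le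
      hn0 hW.le (by positivity) hε₀' hη' hτ
    linarith
  have hbound : ∀ f : S → A → ℝ, (∀ s a, |f s a| ≤ 1) →
      M.Vρ πτ f - ∫ ω, M.Vρ (π t ω) f ∂ℙ ≤
        1 / (1 - M.γ) ^ 2 * (2 * β + 2 * (1 + C₁) + n / 2) * δ := by
    intro f hf
    -- Here the Young parameter is `δ`, which balances a potential of order `δ ^ 2` divided by it.
    refine (CMDP.Vρ_sub_integral_Vρ_le hs hε₀ hε₁ hδ0 halg t hf).trans ?_
    rw [mul_assoc]
    refine mul_le_mul_of_nonneg_left ?_ (by positivity)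
    have h1 : 2 * (∫ ω, M.potential ε₀ πτ lamτ (π t ω) (lam t ω) ∂ℙ) / δ ≤ 2 * (1 + C₁) * δ := by
      rw [div_le_iff₀ hδ0]
      linarith
    linarith
  have hCε : C₂ * δ = ε := by rw [hδ, hc]; field_simp
  have hVr := CMDP.integrable_Vρ (ℙ := ℙ) halg t M.abs_r_le
  have hVg := CMDP.integrable_Vρ (ℙ := ℙ) halg t M.abs_g_le
  have hp1 : 0 ≤ β * (n / (1 - M.γ)) * δ := by positivity
  have hp2 : 0 ≤ β * (L + ξ * n) * δ := by positivity
  refine ⟨⟨(integrable_const _).sub hVr, ?_⟩, ⟨hVg.neg, ?_⟩⟩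
  · rw [integral_sub (integrable_const _) hVr]
    have h1 := hbound M.r M.abs_r_le
    have h2 := hs.optimality_gap hξ hτ0 hstar.1 hstar.2.1
    have h3 := mul_le_mul_of_nonneg_right hτδ (by positivity : 0 ≤ n / (1 - M.γ))
    simp only [integral_const, probReal_univ, one_smul]
    refine le_trans ?_ hCε.le
    rw [hC₂]
    linarith
  · rw [integral_neg]
    have h1 := hbound M.g M.abs_g_le
    have h2 := hs.violation hξ hτ0 hfeas
    have h3 := mul_le_mul_of_nonneg_right hτδ (by positivity : 0 ≤ L + ξ * n)
    refine le_trans ?_ hCε.le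
    rw [hC₂]
    linarith
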